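/- Let $L\ge 2$ and let $\alpha_1,\dots,\alpha_{L-1},\beta,\gamma_1,\dots,\gamma_{L-1}$ be complex parameters; put $\alpha_0=\beta$, $\gamma_0=0$, $\alpha_{k+L}=\alpha_k+1$, $\gamma_{k+L}=\gamma_k+1$, and $a_k=\alpha_k-\gamma_k$, $b_k=-\gamma_k$ $(0\le k\le L-1)$. Consider the system $$\mathcal P_{L,1}:\qquad \frac{d\boldsymbol y}{dx}=\Bigl(\frac1x A_0+\frac1{1-x}A_1\Bigr)\boldsymbol y,\qquad \boldsymbol y={}^{\rm T}(y_0,\dots,y_{L-1}),$$ where $(A_0)_{mn}=a_m$ for $n<m$, $(A_0)_{mm}=b_m$, $(A_0)_{mn}=0$ for $n>m$, and $(A_1)_{mn}=a_m$ for all $m,n$ $(0\le m,n\le L-1)$. Let $t_0=1$, $$U(t)=\prod_{k=1}^{L-1}t_k^{\alpha_k-\gamma_{k+1}}(t_{k-1}-t_k)^{\gamma_k-\alpha_k}\cdot(1-xt_{L-1})^{-\beta},$$ $$\varphi_0=\frac{dt_1\wedge\cdots\wedge dt_{L-1}}{\prod_{k=1}^{L-1}(t_{k-1}-t_k)},\qquad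 \varphi_m=\frac{dt_1\wedge\cdots\wedge dt_{L-1}}{(xt_{L-1}-1)\prod_{1\le k\le L-1,\,k\ne m}(t_{k-1}-t_k)}\quad(1\le m\le L-1).$$ In homogeneous coordinates $t_k=\tau_k/\tau_0$, extended by $\tau_{k+L}=\tau_k/x$, let $$\Delta_n=\{0\le\tau_{n+L-1}\le\cdots\le\tau_{n+1}\le\tau_n\}\qquad(0\le n\le L-1),$$ i.e. $\tau_n,\dots,\tau_{n+L-1}$ are, up to a common factor, real, nonnegative and decreasing. Let $0<|x|<1$; all functions of $x$ below are multi-valued on this punctured disc, i.e. are functions of $\log x$ with $\mathrm{Re}\log x<0$. On each $\Delta_n$ fix any branch of $U$ (that is, of the logarithms of $t_k$, $t_{k-1}-t_k$ and $1-xt_{L-1}$) which is continuous in $t$ in the interior of $\Delta_n$ and in $\log x$. For each $n$, if $\mathrm{Re}\,\gamma_n<\mathrm{Re}\,\alpha_{n+k}<\mathrm{Re}\,\gamma_{n+k}$ for $1\le k\le L-1$, then the integrals $\int_{\Delta_n}U\varphi_m$ $(0\le m\le L-1)$ converge absolutely. For fixed $x$, all these integrals extend holomorphically in $(\alpha,\beta,\gamma)$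 to the set $\mathcal G$ of generic parameters, for which none of $$\alpha_{n+k}-\gamma_n,\quad \gamma_{n+k}-\alpha_{n+k},\quad \gamma_{n+k}-\gamma_n\qquad(0\le n\le L-1,\ 1\le k\le L-1)$$ is a nonpositive integer. With the integrals so understood, for all parameters in $\mathcal G$ the matrix $$Y(x)=\Bigl(\int_{\Delta_n}U\varphi_m\Bigr)_{0\le m,n\le L-1}$$ is a fundamental system of solutions of $\mathcal P_{L,1}$ (its columns are a basis of the space of solutions on $0<|x|<1$), and $$Y(x)=\Phi(x)\,\mathrm{diag}(1,x^{b_1},\dots,x^{b_{L-1}})$$ with $\Phi$ holomorphic in $|x|<1$, $\Phi(0)$ lower triangular and $\Phi(0)$ invertible. -/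

import Mathlib

open Set MeasureTheory

noncomputable section

namespace ThomaeSystem

/-- The entry number `k` of `(v_1, …, v_{L-1})`, with the value `d` for `k` outside `1, …, L-1`. -/
def coord {R : Type} (L : ℕ) (d : R) (v : Fin (L - 1) → R) (k : ℕ) : R :=
  if h : 0 < k ∧ k < L then v ⟨k - 1, by omega⟩ else d

/-- The parameter space: triples `(α, β, γ)` with `α = (α_1, …, α_{L-1})`, `β ∈ ℂ`,
`γ = (γ_1, …, γ_{L-1})`. -/
abbrev Params (L : ℕ) : Type := (Fin (L - 1) → ℂ) × ℂ × (Fin (L - 1) → ℂ)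

variable {L : ℕ}

/-- `β`. -/
def Params.beta (p : Params L) : ℂ := p.2.1

/-- `α_k` for `k ≥ 0`, with `α_0 = β` and `α_{k+L} = α_k + 1`. -/
def Params.alpha (p : Params L) (k : ℕ) : ℂ := coord L p.2.1 p.1 (k % L) + (k / L : ℕ)

/-- `γ_k` for `k ≥ 0`, with `γ_0 = 0` and `γ_{k+L} = γ_k + 1`; in particular `γ_L = 1`. -/
def Params.gamma (p : Params L) (k : ℕ) : ℂ := coord L 0 p.2.2 (k % L) + (k / L : ℕ)

/-- `ζ_k = α_k - γ_{k+1}`. -/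
def Params.zeta (p : Params L) (k : ℕ) : ℂ := p.alpha k - p.gamma (k + 1)

/-- `η_k = γ_k - α_k`. -/
def Params.eta (p : Params L) (k : ℕ) : ℂ := p.gamma k - p.alpha k

/-- `a_k = α_k - γ_k`; in particular `a_0 = β`. -/
def Params.a (p : Params L) (k : ℕ) : ℂ := p.alpha k - p.gamma k

/-- `b_k = -γ_k`; in particular `b_0 = 0`. -/
def Params.b (p : Params L) (k : ℕ) : ℂ := -p.gamma k

/-! ### The differential system -/

/-- The coefficient of `1 / x`: lower triangular with diagonal `(b_0, …, b_{L-1})`, and all entries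
of row `m` to the left of the diagonal equal to `a_m`. -/
def residueZero (p : Params L) : Matrix (Fin L) (Fin L) ℂ :=
  fun m n => if n < m then p.a m else if n = m then p.b m else 0

/-- The coefficient of `1 / (1 - x)`: all entries of row `m` are equal to `a_m`. -/
def residueOne (p : Params L) : Matrix (Fin L) (Fin L) ℂ :=
  fun m _ => p.a m

/-- The matrix `A(x)` of the system `dy/dx = A(x) y`. -/
def coeffMatrix (p : Params L) (x : ℂ) : Matrix (Fin L) (Fin L) ℂ :=
  (1 / x) • residueZero p + (1 / (1 - x)) • residueOne p

/-- The universal cover of the punctured disc `0 < |x| < 1`, with covering map `w ↦ x = exp w`.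
A multi-valued function of `x` near `0` is a function of `w = log x`. -/
def cover : Set ℂ := {w | w.re < 0}

/-- `y` is a (multi-valued) solution of `dy/dx = A(x) y` on `0 < |x| < 1`, written in the
coordinate `w = log x`, where `dy/dw = x dy/dx`. -/
def IsSolution (p : Params L) (y : ℂ → Fin L → ℂ) : Prop :=
  ∀ w ∈ cover,
    HasDerivAt y (Complex.exp w • (coeffMatrix p (Complex.exp w)).mulVec (y w)) w

/-- The columns of `Y` form a basis of the space of solutions. -/
def IsFundamentalSystem (p : Params L) (Y : ℂ → Matrix (Fin L) (Fin L) ℂ) : Prop :=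
  (∀ n : Fin L, IsSolution p (fun w m => Y w m n)) ∧
  ∀ y : ℂ → Fin L → ℂ, IsSolution p y →
    ∃! c : Fin L → ℂ, ∀ w ∈ cover, y w = (Y w).mulVec c

/-- `Y(x) = Φ(x) diag(1, x^{b_1}, …, x^{b_{L-1}})` with `Φ` holomorphic in `|x| < 1`,
`Φ(x) = (lower triangular constant matrix) + O(x)` and `Φ(0)` invertible. -/
def HasTriangularForm (p : Params L) (Y : ℂ → Matrix (Fin L) (Fin L) ℂ) : Prop :=
  ∃ Φ : ℂ → Matrix (Fin L) (Fin L) ℂ,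
    (∀ m n, DifferentiableOn ℂ (fun x => Φ x m n) (Metric.ball 0 1)) ∧
    (∀ w ∈ cover, Y w =
      Φ (Complex.exp w) * Matrix.diagonal (fun n : Fin L => Complex.exp (p.b n * w))) ∧
    (∀ m n : Fin L, m < n → Φ 0 m n = 0) ∧
    IsUnit (Φ 0)

/-! ### The cyclically transformed simplices

For homogeneous coordinates `τ_0, …, τ_{L-1}` with `t_k = τ_k / τ_0`, extended by
`τ_{k+L} = τ_k / x`, the simplex `Δ_n` is `{0 ≤ τ_{n+L-1} ≤ ⋯ ≤ τ_{n+1} ≤ τ_n}`: the numbers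
`τ_n, …, τ_{n+L-1}` are, up to a common factor, real, nonnegative and decreasing. With `τ_0 = 1`
one can write `τ_j = c r_j` for `n ≤ j < n + L`, where `r_0 = 1` and `c = 1` if `n = 0`, and where
`r_L = 1` and `c = τ_L = 1 / x` if `n ≥ 1`. The remaining `L - 1` real numbers `r_j`, indexed by
`u_{j mod L}`, are the coordinates on `Δ_n`. -/

/-- `r_j`. -/
def rseq (L : ℕ) (u : Fin (L - 1) → ℝ) (j : ℕ) : ℝ := coord L 1 u (j % L)

/-- The interior of the simplex `Δ_n` in the coordinates `u`: `0 < r_{n+L-1} < ⋯ < r_{n+1} < r_n`. -/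
def simplex (L n : ℕ) : Set (Fin (L - 1) → ℝ) :=
  {u | 0 < rseq L u (n + L - 1) ∧ ∀ j, n ≤ j → j + 1 < n + L → rseq L u (j + 1) < rseq L u j}

/-- The coordinates `t_0 = 1, t_1, …, t_{L-1}` of the point of `Δ_n` with coordinates `u`:
`t_k = τ_k = u_k / x` if `1 ≤ n ≤ k`; `t_k = u_k` if `n = 0`; and `t_k = x τ_{k+L} = u_k` if
`k < n`. -/
def point (L n : ℕ) (x : ℂ) (u : Fin (L - 1) → ℝ) (k : ℕ) : ℂ :=
  if n ≠ 0 ∧ n ≤ k then (rseq L u k : ℂ) / x else (rseq L u k : ℂ)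

/-- The Jacobian of `u ↦ (t_1, …, t_{L-1})` on `Δ_n`. -/
def jacobian (L n : ℕ) (x : ℂ) : ℂ := if n = 0 then 1 else (1 / x) ^ (L - n)

/-! ### The integrand -/

/-- The rational form `φ_m` divided by `dt_1 ∧ ⋯ ∧ dt_{L-1}`. -/
def phi (L m : ℕ) (x : ℂ) (t : ℕ → ℂ) : ℂ :=
  if m = 0 then 1 / ∏ k ∈ Finset.Icc 1 (L - 1), (t (k - 1) - t k)
  else 1 / ((x * t (L - 1) - 1) * ∏ k ∈ (Finset.Icc 1 (L - 1)).erase m, (t (k - 1) - t k))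

/-- A choice of continuous branches of the logarithms of `t_k`, `t_{k-1} - t_k` `(1 ≤ k ≤ L-1)` and
`1 - x t_{L-1}` along the interior of `Δ_n`, for all `x = exp w` with `0 < |x| < 1`. -/
structure Branch (L n : ℕ) where
  logT : ℕ → ℂ → (Fin (L - 1) → ℝ) → ℂ
  logD : ℕ → ℂ → (Fin (L - 1) → ℝ) → ℂ
  logX : ℂ → (Fin (L - 1) → ℝ) → ℂ
  continuousOn_logT : ∀ k ∈ Finset.Icc 1 (L - 1),
    ContinuousOn (fun q : ℂ × (Fin (L - 1) → ℝ) => logT k q.1 q.2) (cover ×ˢ simplex L n)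
  continuousOn_logD : ∀ k ∈ Finset.Icc 1 (L - 1),
    ContinuousOn (fun q : ℂ × (Fin (L - 1) → ℝ) => logD k q.1 q.2) (cover ×ˢ simplex L n)
  continuousOn_logX :
    ContinuousOn (fun q : ℂ × (Fin (L - 1) → ℝ) => logX q.1 q.2) (cover ×ˢ simplex L n)
  exp_logT : ∀ k ∈ Finset.Icc 1 (L - 1), ∀ w ∈ cover, ∀ u ∈ simplex L n,
    Complex.exp (logT k w u) = point L n (Complex.exp w) u k
  exp_logD : ∀ k ∈ Finset.Icc 1 (L - 1), ∀ w ∈ cover, ∀ u ∈ simplex L n,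
    Complex.exp (logD k w u) =
      point L n (Complex.exp w) u (k - 1) - point L n (Complex.exp w) u k
  exp_logX : ∀ w ∈ cover, ∀ u ∈ simplex L n,
    Complex.exp (logX w u) = 1 - Complex.exp w * point L n (Complex.exp w) u (L - 1)

/-- The branch of `U(t) = ∏_{k=1}^{L-1} t_k^{ζ_k} (t_{k-1} - t_k)^{η_k} · (1 - x t_{L-1})^{-β}`
along `Δ_n` given by a choice of the logarithms. -/
def Branch.U {n : ℕ} (B : Branch L n) (p : Params L) (w : ℂ) (u : Fin (L - 1) → ℝ) : ℂ :=
  Complex.exp (∑ k ∈ Finset.Icc 1 (L - 1), (p.zeta k * B.logT k w u + p.eta k * B.logD k w u)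
    - p.beta * B.logX w u)

/-- The form `U φ_m` on `Δ_n`, in the coordinates `u`. -/
def Branch.integrand {n : ℕ} (B : Branch L n) (p : Params L) (w : ℂ) (m : ℕ)
    (u : Fin (L - 1) → ℝ) : ℂ :=
  B.U p w u * phi L m (Complex.exp w) (point L n (Complex.exp w) u) *
    jacobian L n (Complex.exp w)

/-! ### Parameters -/

/-- The parameters for which the integrals over `Δ_n` converge absolutely:
`Re γ_n < Re α_{n+k} < Re γ_{n+k}` for `1 ≤ k ≤ L-1`. -/
def convergent (L n : ℕ) : Set (Params L) :=
  {p | ∀ k ∈ Finset.Icc 1 (L - 1),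
    (p.gamma n).re < (p.alpha (n + k)).re ∧ (p.alpha (n + k)).re < (p.gamma (n + k)).re}

/-- The generic parameters: for `0 ≤ n ≤ L-1` and `1 ≤ k ≤ L-1`, none of `α_{n+k} - γ_n`,
`γ_{n+k} - α_{n+k}`, `γ_{n+k} - γ_n` is a nonpositive integer. -/
def generic (L : ℕ) : Set (Params L) :=
  {p | ∀ n < L, ∀ k ∈ Finset.Icc 1 (L - 1), ∀ j : ℕ,
    p.alpha (n + k) - p.gamma n ≠ -(j : ℂ) ∧
    p.gamma (n + k) - p.alpha (n + k) ≠ -(j : ℂ) ∧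
    p.gamma (n + k) - p.gamma n ≠ -(j : ℂ)}

end ThomaeSystem

end

/-!
Fix `n` and write `e(N)` for the solution of the first order recurrence
`(γ_N - γ_n) e(N + 1) = (α_N - γ_n) e(N)` with `e(N) = 0` for `N ≤ n` and `e(n + 1) = 1`. Up to a
factor independent of `x` and `m`, the integral of `U φ_m` over `Δ_n` is
`x^{-γ_n} (T_{m+1} - T_m)` with `T_m = ∑ e(m + iL) x^i`, and these functions solve the system.

*Differential system.* For a vector `y` put `T_m = ∑_{k<m} y_k + x/(1-x) ∑_k y_k`, so that
`y_m = T_{m+1} - T_m` and `T_0 = x T_L`. The system then says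
`(x d/dx + γ_m) T_{m+1} = (x d/dx + α_m) T_m`, and since `α` and `γ` increase by `1` over the period
`L`, on the coefficients of the power series this is the single recurrence for `e`
(`frob_recurrence`, `isSolution_localSolution`). The coefficients grow subgeometrically, locally
uniformly in the parameters (`exists_frob_bound`), which gives holomorphy in `x` and in the
parameters. At `x = 0` the `n`-th solution, without its power of `x`, has the components
`e(m + 1) - e(m)`, which vanish for `m < n` and equal `1` for `m = n`. So the solutions are
independent, and by Grönwall's inequality they span all solutions
(`isFundamentalSystem_localSolution`).

*Integrals.* In the ratios `s_k = τ_{n+k} / τ_{n+k-1}`, `1 ≤ k ≤ L - 1`, the simplex `Δ_n` becomes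
the unit cube. The map is linear in logarithmic coordinates, so it preserves `∏ du_i / u_i` up to a
positive constant, whose value does not matter (`exists_integral_simplex_eq`). By the cyclic
symmetry of `U` and of the forms `φ_m`, the integrand becomes that of Euler's integral
`∏ s_k^{α_{n+k} - γ_n - 1} (1 - s_k)^{γ_{n+k} - α_{n+k} - 1} (1 - x s_1 ⋯ s_{L-1})^{γ_n - α_n}`,
with some exponents shifted by `1` according to `m`; the branches of the logarithms contribute a
factor that depends on the parameters only (`Branch.exists_integrand_eq`). Expanding the last factor in the
binomial series and integrating termwise gives products of Beta functions (`euler_integral`), whose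
recurrences identify them with `e(N + 1) - e(N)` times a product of Gamma functions (`euler_coeff`).
That product is holomorphic and nonzero for generic parameters, so the formula also furnishes the
continuation in the parameters.
-/

noncomputable section

namespace ThomaeSystem

variable {L : ℕ}

/-! ### The parameter sequences -/

theorem alpha_add_mul (hL : 0 < L) (p : Params L) (k i : ℕ) :
    p.alpha (k + i * L) = p.alpha k + i := by
  simp only [Params.alpha, Nat.add_mul_mod_self_right, Nat.add_mul_div_right _ _ hL]
  push_cast
  ring

theorem gamma_add_mul (hL : 0 < L) (p : Params L) (k i : ℕ) :
    p.gamma (k + i * L) = p.gamma k + i := by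
  simp only [Params.gamma, Nat.add_mul_mod_self_right, Nat.add_mul_div_right _ _ hL]
  push_cast
  ring

theorem norm_coord_le {L : ℕ} {r : ℝ} {d : ℂ} {v : Fin (L - 1) → ℂ} (hd : ‖d‖ ≤ r) (hv : ‖v‖ ≤ r)
    (k : ℕ) : ‖coord L d v k‖ ≤ r := by
  unfold coord
  split_ifs
  · exact (norm_le_pi_norm v _).trans hv
  · exact hd

theorem norm_alpha_sub_le (p : Params L) (k : ℕ) : ‖p.alpha k - (k / L : ℕ)‖ ≤ ‖p‖ := by
  rw [Params.alpha, add_sub_cancel_right]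
  exact norm_coord_le ((norm_fst_le p.2).trans (norm_snd_le p)) (norm_fst_le p) _

theorem norm_gamma_sub_le (p : Params L) (k : ℕ) : ‖p.gamma k - (k / L : ℕ)‖ ≤ ‖p‖ := by
  rw [Params.gamma, add_sub_cancel_right]
  exact norm_coord_le (by simp) ((norm_snd_le p.2).trans (norm_snd_le p)) _

theorem differentiable_alpha (k : ℕ) : Differentiable ℂ fun p : Params L => p.alpha k := by
  unfold Params.alpha coord
  split_ifs <;> fun_prop

theorem differentiable_gamma (k : ℕ) : Differentiable ℂ fun p : Params L => p.gamma k := by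
  unfold Params.gamma coord
  split_ifs <;> fun_prop

theorem differentiableAt_finset_prod {E ι : Type*} [NormedAddCommGroup E] [NormedSpace ℂ E]
    {s : Finset ι} {f : ι → E → ℂ} {x : E} (h : ∀ i ∈ s, DifferentiableAt ℂ (f i) x) :
    DifferentiableAt ℂ (fun y => ∏ i ∈ s, f i y) x := by
  classical
  exact (HasFDerivAt.finsetProd fun i hi => (h i hi).hasFDerivAt).differentiableAt

/-! ### The coefficients of the local solutions at the origin -/

/-- The solution `e(N)` of the first order recurrence
`(γ_N - γ_n) e(N + 1) = (α_N - γ_n) e(N)` with `e(N) = 0` for `N ≤ n` and `e(n + 1) = 1`. -/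
def frob (p : Params L) (n N : ℕ) : ℂ :=
  if N ≤ n then 0
  else ∏ j ∈ Finset.Ioo n N, (p.alpha j - p.gamma n) / (p.gamma j - p.gamma n)

/-- The exponent `-γ_n` differs from no `-γ_N`, `N > n`: the Frobenius method yields a solution
with the exponent `-γ_n`. -/
def NonResonant (p : Params L) (n : ℕ) : Prop := ∀ N, n < N → p.gamma N - p.gamma n ≠ 0

theorem frob_of_le (p : Params L) {n N : ℕ} (h : N ≤ n) : frob p n N = 0 := if_pos h

theorem frob_self_succ (p : Params L) (n : ℕ) : frob p n (n + 1) = 1 := by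
  have : Finset.Ioo n (n + 1) = ∅ := by ext; simp
  simp [frob, this]

theorem frob_succ (p : Params L) {n N : ℕ} (h : n < N) :
    frob p n (N + 1) = frob p n N * ((p.alpha N - p.gamma n) / (p.gamma N - p.gamma n)) := by
  have : Finset.Ioo n (N + 1) = insert N (Finset.Ioo n N) := by ext; simp; omega
  rw [frob, frob, if_neg (by omega), if_neg (by omega), this, Finset.prod_insert (by simp),
    mul_comm]

theorem frob_recurrence {p : Params L} {n : ℕ} (hp : NonResonant p n) (N : ℕ) :
    (p.gamma N - p.gamma n) * frob p n (N + 1) = (p.alpha N - p.gamma n) * frob p n N := by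
  rcases lt_trichotomy N n with h | rfl | h
  · rw [frob_of_le p h, frob_of_le p h.le]; simp
  · rw [frob_of_le p le_rfl]; simp
  · rw [frob_succ p h]
    have := hp N h
    field_simp

/-- The quotients `e(N + 1) / e(N) = 1 + (α_N - γ_N) / (γ_N - γ_n)` tend to `1`, uniformly for
bounded parameters: the numerator is bounded, and the denominator is `N / L` up to a bounded
error. -/
theorem norm_frob_ratio_le (p : Params L) {n N : ℕ} (hn : n < L) {K ρ : ℝ} (hK : ‖p‖ ≤ K)
    (hρ : 1 < ρ) (hN : 2 * K + 2 * K / (ρ - 1) < (N / L : ℕ)) :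
    p.gamma N - p.gamma n ≠ 0 ∧
      ‖(p.alpha N - p.gamma n) / (p.gamma N - p.gamma n)‖ ≤ ρ := by
  have hK0 : 0 ≤ K := (norm_nonneg p).trans hK
  have hd : 0 < ρ - 1 := sub_pos.2 hρ
  have h1 := (norm_alpha_sub_le p N).trans hK
  have h2 := (norm_gamma_sub_le p N).trans hK
  have h3 : ‖p.gamma n‖ ≤ K := by
    have := (norm_gamma_sub_le p n).trans hK
    rwa [Nat.div_eq_of_lt hn, Nat.cast_zero, sub_zero] at this
  have h0 : 0 ≤ 2 * K / (ρ - 1) := by positivity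
  have hq : 2 * K / (ρ - 1) < ‖p.gamma N - p.gamma n‖ := by
    have : ‖((N / L : ℕ) : ℂ)‖ ≤ ‖p.gamma N - p.gamma n‖
        + (‖p.gamma N - (N / L : ℕ)‖ + ‖p.gamma n‖) := by
      calc ‖((N / L : ℕ) : ℂ)‖
          = ‖(p.gamma N - p.gamma n) - ((p.gamma N - (N / L : ℕ)) - p.gamma n)‖ := by
            congr 1; ring
        _ ≤ _ := (norm_sub_le _ _).trans (by gcongr; exact norm_sub_le _ _)
    rw [Complex.norm_natCast] at this
    linarith
  have hq' : 0 < ‖p.gamma N - p.gamma n‖ := h0.trans_lt hq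
  refine ⟨norm_pos_iff.1 hq', ?_⟩
  rw [norm_div, div_le_iff₀ hq']
  have h4 : ‖p.alpha N - p.gamma n‖ ≤ ‖p.gamma N - p.gamma n‖ + 2 * K := by
    calc ‖p.alpha N - p.gamma n‖ = ‖(p.gamma N - p.gamma n) + ((p.alpha N - (N / L : ℕ))
          - (p.gamma N - (N / L : ℕ)))‖ := by congr 1; ring
      _ ≤ _ := (norm_add_le _ _).trans (by
        gcongr; exact (norm_sub_le _ _).trans (by linarith))
  have h5 := (div_le_iff₀ hd).1 hq.le
  nlinarith

/-- The coefficients `e(N)` are holomorphic near a non-resonant parameter and, locally uniformly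
there, grow more slowly than any geometric sequence of ratio `> 1`. -/
theorem exists_frob_bound {p₀ : Params L} {n : ℕ} (hn : n < L) (hp : NonResonant p₀ n)
    {ρ : ℝ} (hρ : 1 < ρ) : ∃ δ > 0, ∃ M : ℝ, 0 ≤ M ∧
      (∀ N, DifferentiableOn ℂ (fun p => frob p n N) (Metric.ball p₀ δ)) ∧
      ∀ p ∈ Metric.ball p₀ δ, ∀ N, ‖frob p n N‖ ≤ M * ρ ^ N := by
  have hL : 0 < L := by omega
  set K := ‖p₀‖ + 1
  obtain ⟨Q, hQ⟩ := exists_nat_gt (2 * K + 2 * K / (ρ - 1))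
  set N₀ := Q * L
  have hlarge : ∀ N, N₀ ≤ N → 2 * K + 2 * K / (ρ - 1) < (N / L : ℕ) := fun N hN =>
    hQ.trans_le (by exact_mod_cast (Nat.le_div_iff_mul_le hL).2 hN)
  have hdiff : ∀ p : Params L, NonResonant p n → ∀ N,
      DifferentiableAt ℂ (fun p => frob p n N) p := by
    intro p hp N
    unfold frob
    split_ifs with h
    · exact differentiableAt_const _
    · refine differentiableAt_finset_prod fun j hj => ?_
      simp only [div_eq_mul_inv]
      exact ((differentiable_alpha j p).fun_sub (differentiable_gamma n p)).fun_mul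
        (((differentiable_gamma j p).fun_sub (differentiable_gamma n p)).fun_inv
          (hp j (Finset.mem_Ioo.1 hj).1))
  have h1 : ∀ᶠ p in nhds p₀, ‖p‖ ≤ K :=
    ((continuous_norm.continuousAt (x := p₀)).eventually_lt continuousAt_const
      (by simp [K])).mono fun _ h => h.le
  -- For `N ≥ N₀` the denominators are bounded below by the size of the parameters alone; the
  -- finitely many others stay nonzero near `p₀` by continuity.
  have h2 : ∀ᶠ p in nhds p₀, ∀ N ∈ Finset.range N₀, n < N → p.gamma N - p.gamma n ≠ 0 := by
    rw [Filter.eventually_all_finset]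
    intro N _
    by_cases h : n < N
    · have := (((differentiable_gamma N).sub (differentiable_gamma n)).continuous.continuousAt
        (x := p₀)).eventually_ne (hp N h)
      filter_upwards [this] with p hp _ using hp
    · exact Filter.Eventually.of_forall fun p h' => absurd h' h
  have h3 : ∀ᶠ p in nhds p₀, ∀ N ∈ Finset.range (N₀ + 1), ‖frob p n N‖ ≤ ‖frob p₀ n N‖ + 1 := by
    rw [Filter.eventually_all_finset]
    intro N _
    exact (((hdiff p₀ hp N).continuousAt.norm).eventually_lt continuousAt_const (by simp)).mono
      fun _ h => h.le
  obtain ⟨δ, hδ, hball⟩ := Metric.eventually_nhds_iff_ball.1 (h1.and (h2.and h3))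
  set M := ∑ N ∈ Finset.range (N₀ + 1), (‖frob p₀ n N‖ + 1)
  have hM : 0 ≤ M := by positivity
  refine ⟨δ, hδ, M, hM, ?_, ?_⟩
  · intro N p hpb
    obtain ⟨hp1, hp2, -⟩ := hball p hpb
    refine (hdiff p (fun N hN => ?_) N).differentiableWithinAt
    by_cases h : N < N₀
    · exact hp2 N (Finset.mem_range.2 h) hN
    · exact (norm_frob_ratio_le p hn hp1 hρ (hlarge N (by omega))).1
  · intro p hpb N
    obtain ⟨hp1, hp2, hp3⟩ := hball p hpb
    have hsmall : ∀ N ≤ N₀, ‖frob p n N‖ ≤ M * ρ ^ N := by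
      intro N hN
      have hN' : N ∈ Finset.range (N₀ + 1) := Finset.mem_range.2 (by omega)
      calc ‖frob p n N‖ ≤ ‖frob p₀ n N‖ + 1 := hp3 N hN'
        _ ≤ M := Finset.single_le_sum (f := fun N => ‖frob p₀ n N‖ + 1)
          (fun i _ => by positivity) hN'
        _ ≤ M * ρ ^ N := le_mul_of_one_le_right hM (one_le_pow₀ hρ.le)
    rcases le_total N N₀ with hN | hN
    · exact hsmall N hN
    · induction N, hN using Nat.le_induction with
      | base => exact hsmall _ le_rfl
      | succ N hN ih =>
        have hr := (norm_frob_ratio_le p hn hp1 hρ (hlarge N hN)).2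
        by_cases h : n < N
        · rw [frob_succ p h, norm_mul, pow_succ, ← mul_assoc]
          exact mul_le_mul ih hr (norm_nonneg _) (by positivity)
        · rcases eq_or_lt_of_le (not_lt.1 h) with rfl | h'
          · exact absurd (sub_self _) (norm_frob_ratio_le p hn hp1 hρ (hlarge N hN)).1
          · rw [frob_of_le p h', norm_zero]
            positivity

/-! ### Sums of holomorphic functions -/

/-- A sum of holomorphic functions of several variables with a summable bound is holomorphic:
the derivatives are bounded by the Schwarz lemma. -/
theorem differentiableAt_tsum_of_norm_le {E : Type*} [NormedAddCommGroup E] [NormedSpace ℂ E]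
    {F : ℕ → E → ℂ} {c : E} {δ : ℝ} (hδ : 0 < δ) {u : ℕ → ℝ} (hu : Summable u)
    (hF : ∀ i, DifferentiableOn ℂ (F i) (Metric.ball c δ))
    (hb : ∀ i, ∀ p ∈ Metric.ball c δ, ‖F i p‖ ≤ u i) :
    DifferentiableAt ℂ (fun p => ∑' i, F i p) c := by
  have hsub : ∀ p ∈ Metric.ball c (δ / 2), Metric.ball p (δ / 2) ⊆ Metric.ball c δ :=
    fun p hp => Metric.ball_subset_ball' (by rw [Metric.mem_ball] at hp; linarith)
  have hsub' : Metric.ball c (δ / 2) ⊆ Metric.ball c δ := Metric.ball_subset_ball (by linarith)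
  have hc : c ∈ Metric.ball c (δ / 2) := Metric.mem_ball_self (by positivity)
  refine (hasFDerivAt_tsum_of_isPreconnected (𝕜 := ℂ) (f' := fun i p => fderiv ℂ (F i) p)
    (hu.mul_left (2 / (δ / 2))) Metric.isOpen_ball (convex_ball c (δ / 2)).isPreconnected
    (fun i p hp => ((hF i).differentiableAt
      (Metric.isOpen_ball.mem_nhds (hsub' hp))).hasFDerivAt) ?_ hc
    (.of_norm_bounded hu fun i => hb i c (hsub' hc)) hc).differentiableAt
  intro i p hp
  refine (Complex.norm_fderiv_le_div_of_mapsTo_ball (R₁ := δ / 2) (R₂ := 2 * u i)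
    ((hF i).mono (hsub p hp)) ?_ (by positivity)).trans_eq (by ring)
  intro q hq
  rw [mem_closedBall_iff_norm]
  exact (norm_sub_le _ _).trans (by
    linarith [hb i q (hsub p hp hq), hb i p (hsub' hp)])

/-- A power series whose coefficients grow subgeometrically is holomorphic in the unit disc, and
`x d/dx` acts on it termwise. -/
theorem powerSeries_unit_disc {a : ℕ → ℂ}
    (ha : ∀ r : ℝ, 0 < r → r < 1 → Summable fun i => ‖a i‖ * r ^ i) :
    DifferentiableOn ℂ (fun x : ℂ => ∑' i : ℕ, a i * x ^ i) (Metric.ball 0 1) ∧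
    (∀ x ∈ Metric.ball (0 : ℂ) 1, Summable fun i => a i * x ^ i) ∧
    ∀ x ∈ Metric.ball (0 : ℂ) 1,
      HasSum (fun i : ℕ => (i : ℂ) * (a i * x ^ i))
        (x * deriv (fun x : ℂ => ∑' i : ℕ, a i * x ^ i) x) := by
  have key : ∀ x ∈ Metric.ball (0 : ℂ) 1, ∃ r : ℝ, 0 < r ∧ r < 1 ∧ x ∈ Metric.ball (0 : ℂ) r := by
    intro x hx
    rw [mem_ball_zero_iff] at hx
    obtain ⟨r, h1, h2⟩ := exists_between hx
    exact ⟨r, (norm_nonneg x).trans_lt h1, h2, mem_ball_zero_iff.2 h1⟩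
  have hb : ∀ r : ℝ, ∀ i : ℕ, ∀ x ∈ Metric.ball (0 : ℂ) r, ‖a i * x ^ i‖ ≤ ‖a i‖ * r ^ i := by
    intro r i x hx
    rw [norm_mul, norm_pow]
    gcongr
    exact (mem_ball_zero_iff.1 hx).le
  have hd : ∀ i : ℕ, Differentiable ℂ fun x : ℂ => a i * x ^ i := fun i => by fun_prop
  refine ⟨fun x hx => ?_, fun x hx => ?_, fun x hx => ?_⟩ <;> obtain ⟨r, h0, h1, hxr⟩ := key x hx
  · exact ((Complex.differentiableOn_tsum_of_summable_norm (ha r h0 h1)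
      (fun i => (hd i).differentiableOn) Metric.isOpen_ball (hb r)).differentiableAt
        (Metric.isOpen_ball.mem_nhds hxr)).differentiableWithinAt
  · exact .of_norm_bounded (ha r h0 h1) fun i => hb r i x hxr
  · have := (Complex.hasSum_deriv_of_summable_norm (ha r h0 h1)
      (fun i => (hd i).differentiableOn) Metric.isOpen_ball (hb r) hxr).mul_left x
    convert! this using 2 with i
    rw [deriv_const_mul_field, deriv_pow_field]
    rcases i with _ | i
    · simp
    · simp [pow_succ]; ring

/-! ### The local solutions -/

/-- The power series `T_m(x) = ∑ e(m + iL) x^i`; the components of the local solution with the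
exponent `-γ_n` are the differences `T_{m+1} - T_m`, up to the factor `x^{-γ_n}`. -/
def frobSeries (p : Params L) (n m : ℕ) (x : ℂ) : ℂ := ∑' i : ℕ, frob p n (m + i * L) * x ^ i

theorem exists_one_lt_pow_mul_lt_one (L : ℕ) {r : ℝ} (hr : r < 1) :
    ∃ ρ : ℝ, 1 < ρ ∧ ρ ^ L * r < 1 := by
  have h : ∀ᶠ ρ : ℝ in nhds 1, ρ ^ L * r < 1 :=
    ContinuousAt.eventually_lt (by fun_prop) continuousAt_const (by simpa using hr)
  obtain ⟨ρ, h1, h2⟩ := ((h.filter_mono nhdsWithin_le_nhds).and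
    (self_mem_nhdsWithin (s := Ioi (1 : ℝ)))).exists
  exact ⟨ρ, h2, h1⟩

theorem summable_frob {p : Params L} {n : ℕ} (hn : n < L) (hp : NonResonant p n) (m : ℕ) {r : ℝ}
    (h0 : 0 < r) (h1 : r < 1) : Summable fun i => ‖frob p n (m + i * L)‖ * r ^ i := by
  obtain ⟨ρ, hρ, hρr⟩ := exists_one_lt_pow_mul_lt_one L h1
  obtain ⟨δ, hδ, M, hM, -, hb⟩ := exists_frob_bound hn hp hρ
  refine .of_nonneg_of_le (fun i => by positivity) (fun i => ?_)
    ((summable_geometric_of_lt_one (by positivity) hρr).mul_left (M * ρ ^ m))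
  calc ‖frob p n (m + i * L)‖ * r ^ i ≤ M * ρ ^ (m + i * L) * r ^ i := by
        gcongr; exact hb p (Metric.mem_ball_self hδ) _
    _ = _ := by rw [mul_pow, ← pow_mul, pow_add, mul_comm i L]; ring

theorem differentiableOn_frobSeries {p : Params L} {n : ℕ} (hn : n < L) (hp : NonResonant p n)
    (m : ℕ) : DifferentiableOn ℂ (frobSeries p n m) (Metric.ball 0 1) :=
  (powerSeries_unit_disc fun _ => summable_frob hn hp m).1

theorem differentiableAt_frobSeries_param {p : Params L} {n : ℕ} (hn : n < L)
    (hp : NonResonant p n) (m : ℕ) {x : ℂ} (hx : ‖x‖ < 1) :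
    DifferentiableAt ℂ (fun p => frobSeries p n m x) p := by
  obtain ⟨ρ, hρ, hρr⟩ := exists_one_lt_pow_mul_lt_one L hx
  obtain ⟨δ, hδ, M, hM, hd, hb⟩ := exists_frob_bound hn hp hρ
  refine differentiableAt_tsum_of_norm_le hδ
    ((summable_geometric_of_lt_one (by positivity) hρr).mul_left (M * ρ ^ m))
    (fun i => (hd _).mul_const _) fun i q hq => ?_
  calc ‖frob q n (m + i * L) * x ^ i‖ ≤ M * ρ ^ (m + i * L) * ‖x‖ ^ i := by
        rw [norm_mul, norm_pow]; gcongr; exact hb q hq _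
    _ = _ := by rw [mul_pow, ← pow_mul, pow_add, mul_comm i L]; ring

theorem frobSeries_apply_zero (p : Params L) (n m : ℕ) : frobSeries p n m 0 = frob p n m := by
  rw [frobSeries, tsum_eq_single 0 (fun i hi => by simp [hi])]
  simp

/-- A series starting at an index `m ≤ n` has no constant term. -/
theorem frobSeries_eq_mul {p : Params L} {n m : ℕ} (hn : n < L) (hp : NonResonant p n)
    (hm : m ≤ n) {x : ℂ} (hx : ‖x‖ < 1) : frobSeries p n m x = x * frobSeries p n (m + L) x := by
  have hs := (powerSeries_unit_disc fun _ => summable_frob hn hp m).2.1 x (by simpa using hx)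
  rw [frobSeries, hs.tsum_eq_zero_add, frobSeries, ← tsum_mul_left]
  simp only [zero_mul, add_zero, frob_of_le p hm, zero_add]
  refine tsum_congr fun i => ?_
  rw [show m + (i + 1) * L = m + L + i * L by ring, pow_succ]
  ring

/-- The system in terms of the partial sums `T_m`:
`(x d/dx + γ_m - γ_n) T_{m+1} = (x d/dx + α_m - γ_n) T_m`. -/
theorem frobSeries_recurrence {p : Params L} {n : ℕ} (hn : n < L) (hp : NonResonant p n) (m : ℕ)
    {x : ℂ} (hx : ‖x‖ < 1) :
    x * deriv (frobSeries p n (m + 1)) x + (p.gamma m - p.gamma n) * frobSeries p n (m + 1) x =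
      x * deriv (frobSeries p n m) x + (p.alpha m - p.gamma n) * frobSeries p n m x := by
  have hx' : x ∈ Metric.ball (0 : ℂ) 1 := by simpa using hx
  have key : ∀ m c, HasSum (fun i : ℕ => (i + c) * (frob p n (m + i * L) * x ^ i))
      (x * deriv (frobSeries p n m) x + c * frobSeries p n m x) := by
    intro m c
    obtain ⟨-, h2, h3⟩ := powerSeries_unit_disc fun _ => summable_frob hn hp m
    simp only [add_mul]
    exact (h3 x hx').add ((h2 x hx').hasSum.mul_left c)
  refine (key (m + 1) _).unique ?_
  convert! key m (p.alpha m - p.gamma n) using 2 with i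
  have := frob_recurrence hp (m + i * L)
  rw [gamma_add_mul (by omega), alpha_add_mul (by omega)] at this
  rw [show m + 1 + i * L = m + i * L + 1 by ring]
  linear_combination x ^ i * this

theorem norm_exp_lt_one {w : ℂ} (hw : w ∈ cover) : ‖Complex.exp w‖ < 1 := by
  rw [Complex.norm_exp, Real.exp_lt_one_iff]
  exact hw

/-- The local solution with the exponent `-γ_n`, as a function of `w = log x`. -/
def localSolution (p : Params L) (n : ℕ) (w : ℂ) (m : Fin L) : ℂ :=
  Complex.exp (p.b n * w) *
    (frobSeries p n (m + 1) (Complex.exp w) - frobSeries p n m (Complex.exp w))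

theorem isSolution_localSolution {p : Params L} {n : ℕ} (hn : n < L) (hp : NonResonant p n) :
    IsSolution p (localSolution p n) := by
  intro w hw
  have hL : 0 < L := by omega
  have hx := norm_exp_lt_one hw
  rw [hasDerivAt_pi]
  intro m
  have hT : ∀ k, HasDerivAt (fun w => frobSeries p n k (Complex.exp w))
      (deriv (frobSeries p n k) (Complex.exp w) * Complex.exp w) w := fun k =>
    ((differentiableOn_frobSeries hn hp k).differentiableAt
      (Metric.isOpen_ball.mem_nhds (by simpa using hx))).hasDerivAt.comp w
        (Complex.hasDerivAt_exp w)
  have hE : HasDerivAt (fun w => Complex.exp (p.b n * w))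
      (Complex.exp (p.b n * w) * (p.b n * 1)) w :=
    (((hasDerivAt_id w).const_mul (p.b n))).cexp
  have h := hE.mul ((hT (m + 1)).sub (hT m))
  refine h.congr_deriv ?_
  have hrec := frobSeries_recurrence hn hp m hx
  have hzero : frobSeries p n 0 (Complex.exp w) =
      Complex.exp w * frobSeries p n L (Complex.exp w) := by
    simpa using frobSeries_eq_mul hn hp (Nat.zero_le n) hx
  set x := Complex.exp w with hxdef
  have hx0 : x ≠ 0 := Complex.exp_ne_zero w
  have hx1 : 1 - x ≠ 0 := by
    intro h
    rw [← sub_eq_zero.1 h] at hx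
    simp at hx
  set E := Complex.exp (p.b n * w)
  set T := fun k => frobSeries p n k x
  -- The sums over the components telescope.
  have hsum : ∑ k : Fin L, localSolution p n w k = E * (T L - T 0) := by
    simp only [localSolution]
    rw [← Finset.mul_sum, Fin.sum_univ_eq_sum_range (fun k => T (k + 1) - T k) L,
      Finset.sum_range_sub]
  have hlow : ∑ k : Fin L, residueZero p m k * localSolution p n w k
      = p.a m * (E * (T m - T 0)) + p.b m * (E * (T (m + 1) - T m)) := by
    have h1 : ∀ k : Fin L, residueZero p m k * localSolution p n w k =
        (fun k : ℕ => (if k < m then p.a m * (E * (T (k + 1) - T k)) else 0) +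
          (if k = m then p.b m * (E * (T (m + 1) - T m)) else 0)) k := by
      intro k
      simp only [residueZero, localSolution, Fin.lt_def, Fin.ext_iff]
      rcases lt_trichotomy (k : ℕ) m with h | h | h
      · simp [h, h.ne, T, E, x]
      · simp [h, T, E, x]
      · simp [h.ne', h.not_gt]
    rw [Finset.sum_congr rfl fun k _ => h1 k, Fin.sum_univ_eq_sum_range
      (fun k : ℕ => (if k < m then p.a m * (E * (T (k + 1) - T k)) else 0) +
          (if k = m then p.b m * (E * (T (m + 1) - T m)) else 0)) L, Finset.sum_add_distrib,
      Finset.sum_ite_eq', if_pos (Finset.mem_range.2 m.2), ← Finset.sum_filter]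
    have : (Finset.range L).filter (· < (m : ℕ)) = Finset.range m := by
      ext k; simp; omega
    rw [this, ← Finset.mul_sum, ← Finset.mul_sum, Finset.sum_range_sub]
  have hA : (x • (coeffMatrix p x).mulVec (localSolution p n w)) m =
      (∑ k, residueZero p m k * localSolution p n w k) +
        x / (1 - x) * (p.a m * ∑ k, localSolution p n w k) := by
    simp only [coeffMatrix, Matrix.add_mulVec, Matrix.smul_mulVec, Pi.smul_apply, Pi.add_apply,
      smul_eq_mul, Matrix.mulVec, dotProduct, residueOne, ← Finset.mul_sum]
    field_simp
  rw [hA, hlow, hsum]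
  simp only [Params.a, Params.b] at *
  change _ = (p.alpha m - p.gamma m) * (E * (T m - T 0)) + _ + _
  have hz : T 0 = x * T L := hzero
  have hr : x * deriv (frobSeries p n (m + 1)) x + (p.gamma m - p.gamma n) * T (m + 1) =
      x * deriv (frobSeries p n m) x + (p.alpha m - p.gamma n) * T m := hrec
  change E * (-p.gamma n * 1) * (T (m + 1) - T m) + E * _ = _
  have hq : x / (1 - x) * ((p.alpha m - p.gamma m) * (E * (T L - x * T L))) =
      x * ((p.alpha m - p.gamma m) * (E * T L)) := by
    field_simp
  rw [hz, hq]
  linear_combination E * hr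

/-! ### Fundamental systems -/

theorem exp_ne_one_of_mem_cover {w : ℂ} (hw : w ∈ cover) : 1 - Complex.exp w ≠ 0 := by
  intro h
  have := norm_exp_lt_one hw
  rw [← sub_eq_zero.1 h] at this
  simp at this

theorem continuousOn_coeffMatrix (p : Params L) (i j : Fin L) :
    ContinuousOn (fun w => coeffMatrix p (Complex.exp w) i j) cover := by
  simp only [coeffMatrix, Matrix.add_apply, Matrix.smul_apply, smul_eq_mul]
  refine ContinuousOn.add (ContinuousOn.mul (continuousOn_const.div (by fun_prop) fun w _ =>
    Complex.exp_ne_zero w) continuousOn_const) (ContinuousOn.mul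
    (continuousOn_const.div (by fun_prop) fun w hw => exp_ne_one_of_mem_cover hw)
      continuousOn_const)

theorem norm_mulVec_le (A : Matrix (Fin L) (Fin L) ℂ) (v : Fin L → ℂ) :
    ‖A.mulVec v‖ ≤ (∑ i, ∑ j, ‖A i j‖) * ‖v‖ := by
  refine (pi_norm_le_iff_of_nonneg (by positivity)).2 fun i => ?_
  have h1 : ‖A.mulVec v i‖ ≤ ∑ j, ‖A i j‖ * ‖v‖ := by
    refine (norm_sum_le Finset.univ fun j => A i j * v j).trans
      (Finset.sum_le_sum fun j _ => ?_)
    rw [norm_mul]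
    gcongr
    exact norm_le_pi_norm v j
  rw [← Finset.sum_mul] at h1
  refine h1.trans (mul_le_mul_of_nonneg_right ?_ (norm_nonneg v))
  exact Finset.single_le_sum (f := fun i => ∑ j, ‖A i j‖) (fun i _ => by positivity)
    (Finset.mem_univ i)

theorem convex_cover : Convex ℝ cover := convex_halfSpace_re_lt 0

/-- A solution vanishing at one point of the cover vanishes: Grönwall's inequality along a
segment. -/
theorem IsSolution.eq_zero {p : Params L} {y : ℂ → Fin L → ℂ} (hy : IsSolution p y) {w₀ : ℂ}
    (hw₀ : w₀ ∈ cover) (h0 : y w₀ = 0) {w : ℂ} (hw : w ∈ cover) : y w = 0 := by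
  set g : ℝ → ℂ := fun t => w₀ + t * (w - w₀)
  have hg : ∀ t ∈ Icc (0 : ℝ) 1, g t ∈ cover := fun t ht => by
    have := convex_cover.add_smul_sub_mem hw₀ hw ht
    simpa [g] using this
  have hgd : ∀ t, HasDerivAt g (w - w₀) t := fun t => by
    have := ((Complex.ofRealCLM.hasDerivAt (x := t)).mul_const (w - w₀)).const_add w₀
    rwa [Complex.ofRealCLM_apply, Complex.ofReal_one, one_mul] at this
  have hgc : Continuous g := by fun_prop
  set B : ℝ → Matrix (Fin L) (Fin L) ℂ := fun t =>
    ((w - w₀) * Complex.exp (g t)) • coeffMatrix p (Complex.exp (g t))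
  have hB : ContinuousOn (fun t => ∑ i, ∑ j, ‖B t i j‖) (Icc 0 1) := by
    refine continuousOn_finsetSum _ fun i _ => continuousOn_finsetSum _ fun j _ => ?_
    refine ContinuousOn.norm (ContinuousOn.mul (by fun_prop) ?_)
    exact (continuousOn_coeffMatrix p i j).comp hgc.continuousOn hg
  obtain ⟨K, hK⟩ := isCompact_Icc.bddAbove_image hB
  have hd : ∀ t ∈ Icc (0 : ℝ) 1, HasDerivAt (y ∘ g) ((B t).mulVec ((y ∘ g) t)) t := fun t ht => by
    have := (hy (g t) (hg t ht)).scomp t (hgd t)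
    refine this.congr_deriv ?_
    simp only [B, mul_smul, Matrix.smul_mulVec, Function.comp_apply]
  have := eq_zero_of_abs_deriv_le_mul_abs_self_of_eq_zero_right (K := K) (f := y ∘ g) (a := 0)
    (b := 1) (fun t ht => (hd t ht).continuousAt.continuousWithinAt)
    (fun t ht => (hd t (Ico_subset_Icc_self ht)).hasDerivWithinAt)
    (by simpa [g] using h0)
    (fun t ht => (norm_mulVec_le _ _).trans (by
      gcongr
      exact hK (mem_image_of_mem _ (Ico_subset_Icc_self ht)))) 1 (right_mem_Icc.2 zero_le_one)
  simpa [g] using this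

theorem IsSolution.mulVec {p : Params L} {Y : ℂ → Matrix (Fin L) (Fin L) ℂ}
    (hY : ∀ n : Fin L, IsSolution p fun w m => Y w m n) (c : Fin L → ℂ) :
    IsSolution p fun w => (Y w).mulVec c := by
  intro w hw
  have h := HasDerivAt.fun_sum (u := Finset.univ) fun n _ => (hY n w hw).const_smul (c n)
  convert! h using 1
  · ext w m
    simp [Matrix.mulVec, dotProduct, mul_comm]
  · have : (Y w).mulVec c = ∑ n, c n • fun m => Y w m n := by
      ext m
      simp [Matrix.mulVec, dotProduct, mul_comm]
    dsimp only
    rw [this, Matrix.mulVec_sum, Finset.smul_sum]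
    refine Finset.sum_congr rfl fun n _ => ?_
    rw [Matrix.mulVec_smul, smul_comm]

theorem isFundamentalSystem_of_det_ne_zero {p : Params L} {Y : ℂ → Matrix (Fin L) (Fin L) ℂ}
    (hY : ∀ n : Fin L, IsSolution p fun w m => Y w m n) {w₀ : ℂ} (hw₀ : w₀ ∈ cover)
    (hdet : IsUnit (Y w₀)) : IsFundamentalSystem p Y := by
  refine ⟨hY, fun y hy => ?_⟩
  have hd : IsUnit (Y w₀).det := (Matrix.isUnit_iff_isUnit_det _).1 hdet
  refine ⟨(Y w₀)⁻¹.mulVec (y w₀), fun w hw => ?_, fun c hc => ?_⟩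
  · set c := (Y w₀)⁻¹.mulVec (y w₀)
    have hs : IsSolution p fun w => y w - (Y w).mulVec c := by
      intro w hw
      have := (hy w hw).fun_sub (IsSolution.mulVec hY c w hw)
      rwa [← smul_sub, ← Matrix.mulVec_sub] at this
    refine sub_eq_zero.1 (hs.eq_zero hw₀ ?_ hw)
    simp [c, Matrix.mulVec_mulVec, Matrix.mul_nonsing_inv _ hd]
  · rw [hc w₀ hw₀, Matrix.mulVec_mulVec, Matrix.nonsing_inv_mul _ hd, Matrix.one_mulVec]

/-- The holomorphic factor of the matrix of local solutions, the `n`-th of them multiplied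
by `c n`. -/
def frobMatrix (p : Params L) (c : Fin L → ℂ) (x : ℂ) : Matrix (Fin L) (Fin L) ℂ :=
  fun m n => c n * (frobSeries p n (m + 1) x - frobSeries p n m x)

theorem frobMatrix_mul_diagonal (p : Params L) (c : Fin L → ℂ) (w : ℂ) :
    frobMatrix p c (Complex.exp w) * Matrix.diagonal (fun n : Fin L => Complex.exp (p.b n * w)) =
      Matrix.of fun m n => c n * localSolution p n w m := by
  ext m n
  rw [Matrix.mul_diagonal, Matrix.of_apply, frobMatrix, localSolution]
  ring

theorem frobMatrix_zero_of_lt (p : Params L) (c : Fin L → ℂ) {m n : Fin L} (h : m < n) :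
    frobMatrix p c 0 m n = 0 := by
  have h' : (m : ℕ) < n := h
  rw [frobMatrix, frobSeries_apply_zero, frobSeries_apply_zero, frob_of_le p h'.le,
    frob_of_le p h', sub_self, mul_zero]

theorem isUnit_frobMatrix_zero (p : Params L) {c : Fin L → ℂ} (hc : ∀ n, c n ≠ 0) :
    IsUnit (frobMatrix p c 0) := by
  rw [Matrix.isUnit_iff_isUnit_det, Matrix.det_of_isLowerTriangular _ fun i j h =>
    frobMatrix_zero_of_lt p c (by simpa using h), isUnit_iff_ne_zero, Finset.prod_ne_zero_iff]
  intro n _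
  rw [frobMatrix, frobSeries_apply_zero, frobSeries_apply_zero, frob_of_le p le_rfl,
    frob_self_succ, sub_zero, mul_one]
  exact hc n

theorem differentiableOn_frobMatrix {p : Params L} (hp : ∀ n < L, NonResonant p n)
    (c : Fin L → ℂ) (m n : Fin L) :
    DifferentiableOn ℂ (fun x => frobMatrix p c x m n) (Metric.ball 0 1) :=
  ((differentiableOn_frobSeries n.2 (hp n n.2) _).sub
    (differentiableOn_frobSeries n.2 (hp n n.2) _)).const_mul (c n)

theorem hasTriangularForm_localSolution {p : Params L} (hp : ∀ n < L, NonResonant p n)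
    {c : Fin L → ℂ} (hc : ∀ n, c n ≠ 0) :
    HasTriangularForm p fun w => Matrix.of fun m n => c n * localSolution p n w m :=
  ⟨frobMatrix p c, differentiableOn_frobMatrix hp c,
    fun w _ => (frobMatrix_mul_diagonal p c w).symm, fun _ _ => frobMatrix_zero_of_lt p c,
    isUnit_frobMatrix_zero p hc⟩

/-- The local solutions form a fundamental system: their matrix is invertible for small `|x|`,
since its holomorphic factor is invertible at `x = 0`. -/
theorem isFundamentalSystem_localSolution {p : Params L} (hp : ∀ n < L, NonResonant p n)
    {c : Fin L → ℂ} (hc : ∀ n, c n ≠ 0) :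
    IsFundamentalSystem p fun w => Matrix.of fun m n => c n * localSolution p n w m := by
  have hcont : ContinuousAt (fun x => (frobMatrix p c x).det) 0 := by
    refine ContinuousAt.comp (g := Matrix.det) (f := frobMatrix p c)
      (continuous_id.matrix_det.continuousAt) ?_
    refine continuousAt_pi.2 fun m => continuousAt_pi.2 fun n => ?_
    exact ((differentiableOn_frobMatrix hp c m n).differentiableAt
      (Metric.ball_mem_nhds 0 one_pos)).continuousAt
  have h0 : (frobMatrix p c 0).det ≠ 0 :=
    ((Matrix.isUnit_iff_isUnit_det _).1 (isUnit_frobMatrix_zero p hc)).ne_zero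
  have hlim : Filter.Tendsto (fun t : ℝ => Complex.exp t) Filter.atBot (nhds 0) := by
    rw [tendsto_zero_iff_norm_tendsto_zero]
    simpa [Complex.norm_exp] using Real.tendsto_exp_atBot
  obtain ⟨t, ht, ht0⟩ := ((hlim.eventually (hcont.eventually_ne h0)).and
    (Filter.eventually_lt_atBot 0)).exists
  refine isFundamentalSystem_of_det_ne_zero (fun n w hw => ?_) (w₀ := t)
    (by simpa [cover] using ht0) ?_
  · have := (isSolution_localSolution n.2 (hp n n.2) w hw).const_smul (c n)
    rw [smul_comm, ← Matrix.mulVec_smul] at this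
    exact this
  · rw [← frobMatrix_mul_diagonal]
    refine IsUnit.mul ((Matrix.isUnit_iff_isUnit_det _).2 ht.isUnit) ?_
    rw [Matrix.isUnit_diagonal, Pi.isUnit_iff]
    exact fun n => (Complex.exp_ne_zero _).isUnit

/-! ### Multiplicative coordinates on the simplices -/

/-- The ratios `s_i = r_{n+i} / r_{n+i-1}`, `1 ≤ i ≤ L - 1` (the index `i : Fin (L - 1)` stands for
`i + 1`): coordinates which identify the interior of `Δ_n` with an open cube. -/
def ratio (L n : ℕ) (u : Fin (L - 1) → ℝ) (i : Fin (L - 1)) : ℝ :=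
  rseq L u (n + i + 1) / rseq L u (n + i)

/-- The open unit cube. -/
def unitCube (L : ℕ) : Set (Fin (L - 1) → ℝ) := Set.univ.pi fun _ => Ioo 0 1

theorem rseq_add (u : Fin (L - 1) → ℝ) (j : ℕ) : rseq L u (j + L) = rseq L u j := by
  simp [rseq]

theorem rseq_mul (u : Fin (L - 1) → ℝ) (j : ℕ) : rseq L u (j * L) = 1 := by
  simp [rseq, coord]

theorem rseq_self (u : Fin (L - 1) → ℝ) : rseq L u L = 1 := by
  simpa using rseq_mul u 1

theorem rseq_succ (u : Fin (L - 1) → ℝ) (i : Fin (L - 1)) : rseq L u (i + 1) = u i := by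
  have h := i.2
  have h1 : ((i : ℕ) + 1) % L = i + 1 := Nat.mod_eq_of_lt (by omega)
  simp only [rseq, h1, coord]
  rw [dif_pos ⟨by omega, by omega⟩]
  rfl

/-- Every index is congruent to one of `n, …, n + L - 1`. -/
theorem exists_rseq_eq {n : ℕ} (hn : n < L) (j : ℕ) :
    ∃ k, k < L ∧ (n + k) % L = j % L := by
  have hj := Nat.mod_lt j (show 0 < L by omega)
  rcases le_or_gt n (j % L) with h | h
  · exact ⟨j % L - n, by omega, by rw [Nat.add_sub_cancel' h, Nat.mod_mod]⟩
  · exact ⟨j % L + L - n, by omega, by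
      rw [show n + (j % L + L - n) = j % L + L by omega, Nat.add_mod_right, Nat.mod_mod]⟩

theorem rseq_pos {n : ℕ} (hn : n < L) {u : Fin (L - 1) → ℝ} (hu : u ∈ simplex L n) (j : ℕ) :
    0 < rseq L u j := by
  have key : ∀ d, d < L → 0 < rseq L u (n + (L - 1) - d) := by
    intro d
    induction d with
    | zero =>
      intro _
      rw [Nat.sub_zero, ← Nat.add_sub_assoc (by omega)]
      exact hu.1
    | succ d ih =>
      intro hd
      refine (ih (by omega)).trans ?_
      have := hu.2 (n + (L - 1) - (d + 1)) (by omega) (by omega)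
      rwa [show n + (L - 1) - (d + 1) + 1 = n + (L - 1) - d by omega] at this
  obtain ⟨k, hk, hkj⟩ := exists_rseq_eq hn j
  have := key (L - 1 - k) (by omega)
  rw [show n + (L - 1) - (L - 1 - k) = n + k by omega] at this
  rwa [rseq, ← hkj]

theorem pos_of_mem_simplex {n : ℕ} (hn : n < L) {u : Fin (L - 1) → ℝ} (hu : u ∈ simplex L n)
    (i : Fin (L - 1)) : 0 < u i := by
  rw [← rseq_succ u i]
  exact rseq_pos hn hu _

theorem ratio_mem_unitCube {n : ℕ} (hn : n < L) {u : Fin (L - 1) → ℝ} (hu : u ∈ simplex L n) :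
    ratio L n u ∈ unitCube L := fun i _ =>
  ⟨div_pos (rseq_pos hn hu _) (rseq_pos hn hu _), (div_lt_one (rseq_pos hn hu _)).2
    (hu.2 (n + i) (by omega) (by have := i.2; omega))⟩

/-- The logarithm of `r_j` as a linear form in the logarithms of the coordinates. -/
def rlog (L j : ℕ) : (Fin (L - 1) → ℝ) →ₗ[ℝ] ℝ :=
  if h : 0 < j % L ∧ j % L < L then LinearMap.proj ⟨j % L - 1, by omega⟩ else 0

theorem rseq_exp (v : Fin (L - 1) → ℝ) (j : ℕ) :
    rseq L (fun i => Real.exp (v i)) j = Real.exp (rlog L j v) := by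
  unfold rseq coord rlog
  split_ifs <;> simp

/-- The passage from the coordinates `u` to the ratios, in logarithmic coordinates. -/
def ratioLog (L n : ℕ) : (Fin (L - 1) → ℝ) →ₗ[ℝ] (Fin (L - 1) → ℝ) :=
  LinearMap.pi fun i => rlog L (n + i + 1) - rlog L (n + i)

theorem ratio_exp (n : ℕ) (v : Fin (L - 1) → ℝ) :
    ratio L n (fun i => Real.exp (v i)) = fun i => Real.exp (ratioLog L n v i) := by
  ext i
  rw [ratio, rseq_exp, rseq_exp, ← Real.exp_sub]
  rfl

/-- If all ratios are `1`, then `r_n = ⋯ = r_{n+L-1}`; one of these numbers is `r_0` or `r_L`, which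
equals `1`. -/
theorem ratioLog_injective {n : ℕ} (hn : n < L) : Function.Injective (ratioLog L n) := by
  rw [← LinearMap.ker_eq_bot, LinearMap.ker_eq_bot']
  intro v hv
  have hconst : ∀ k, k < L → rlog L (n + k) v = rlog L n v := by
    intro k
    induction k with
    | zero => intro _; rfl
    | succ k ih =>
      intro hk
      rw [← ih (by omega)]
      exact sub_eq_zero.1 (congrFun hv ⟨k, by omega⟩)
  have hmod : ∀ j, rlog L j v = rlog L n v := by
    intro j
    obtain ⟨k, hk, hkj⟩ := exists_rseq_eq hn j
    rw [← hconst k hk]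
    simp only [rlog, hkj]
  ext i
  have hi := i.2
  have h0 : rlog L 0 v = 0 := by simp [rlog]
  have h1 : ((i : ℕ) + 1) % L = i + 1 := Nat.mod_eq_of_lt (by omega)
  have h2 : rlog L (i + 1) v = v i := by
    simp only [rlog, h1]
    rw [dif_pos ⟨by omega, by omega⟩]
    rfl
  rw [← h2, hmod, ← hmod 0, h0]
  rfl

/-- The change of variables `u = exp v`, coordinate by coordinate. -/
theorem integral_image_exp {ι : Type*} [Fintype ι] {T : Set (ι → ℝ)} (hT : MeasurableSet T)
    (g : (ι → ℝ) → ℂ) :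
    (IntegrableOn g ((fun v i => Real.exp (v i)) '' T) ↔
      IntegrableOn (fun v => (∏ i, Real.exp (v i)) • g fun i => Real.exp (v i)) T) ∧
    ∫ u in (fun v i => Real.exp (v i)) '' T, g u =
      ∫ v in T, (∏ i, Real.exp (v i)) • g fun i => Real.exp (v i) := by
  classical
  set D : (ι → ℝ) → (ι → ℝ) →L[ℝ] (ι → ℝ) := fun v =>
    LinearMap.toContinuousLinearMap (Matrix.toLin' (Matrix.diagonal fun i => Real.exp (v i)))
  have hD : ∀ v ∈ T, HasFDerivWithinAt (fun v (i : ι) => Real.exp (v i)) (D v) T v := by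
    intro v _
    refine HasFDerivAt.hasFDerivWithinAt (hasFDerivAt_pi'.2 fun i => ?_)
    have := (hasFDerivAt_apply (𝕜 := ℝ) i v).exp
    refine this.congr_fderiv ?_
    ext x
    simp [D, Matrix.mulVec_diagonal]
  have hdet : ∀ v, |(D v).det| = ∏ i, Real.exp (v i) := by
    intro v
    rw [show (D v).det = LinearMap.det (Matrix.toLin' (Matrix.diagonal fun i => Real.exp (v i)))
      from rfl, LinearMap.det_toLin', Matrix.det_diagonal, abs_of_nonneg (by positivity)]
  have hinj : InjOn (fun v (i : ι) => Real.exp (v i)) T := fun v _ v' _ h =>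
    funext fun i => Real.exp_injective (congrFun h i)
  have h1 := integrableOn_image_iff_integrableOn_abs_det_fderiv_smul volume hT hD hinj g
  have h2 := integral_image_eq_integral_abs_det_fderiv_smul volume hT hD hinj g
  simp only [hdet] at h1 h2
  exact ⟨h1, h2⟩

theorem unitCube_eq_image :
    unitCube L = (fun v i => Real.exp (v i)) '' {z : Fin (L - 1) → ℝ | ∀ i, z i < 0} := by
  ext s
  constructor
  · intro hs
    refine ⟨fun i => Real.log (s i), fun i => ?_, ?_⟩
    · exact Real.log_neg (hs i trivial).1 (hs i trivial).2
    · ext i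
      exact Real.exp_log (hs i trivial).1
  · rintro ⟨z, hz, rfl⟩ i -
    exact ⟨Real.exp_pos _, Real.exp_lt_one_iff.2 (hz i)⟩

theorem simplex_eq_image {n : ℕ} (hn : n < L) :
    simplex L n = (fun v i => Real.exp (v i)) '' (ratioLog L n ⁻¹' {z | ∀ i, z i < 0}) := by
  ext u
  constructor
  · intro hu
    have he : (fun i => Real.exp (Real.log (u i))) = u :=
      funext fun i => Real.exp_log (pos_of_mem_simplex hn hu i)
    refine ⟨fun i => Real.log (u i), fun i => ?_, he⟩
    have h1 := ratio_mem_unitCube hn hu i trivial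
    rw [← he, ratio_exp] at h1
    exact Real.exp_lt_one_iff.1 h1.2
  · rintro ⟨v, hv, rfl⟩
    refine ⟨by rw [rseq_exp]; positivity, fun j hj hjL => ?_⟩
    rw [rseq_exp, rseq_exp, Real.exp_lt_exp, ← sub_neg]
    have := hv ⟨j - n, by omega⟩
    simp only [ratioLog, LinearMap.pi_apply, LinearMap.sub_apply, Nat.add_sub_cancel' hj] at this
    exact this

/-- The passage to the ratios preserves the measure `∏ du_i / u_i` up to a constant factor, being
linear in logarithmic coordinates. -/
theorem exists_integral_simplex_eq {n : ℕ} (hn : n < L) : ∃ κ : ℝ, 0 < κ ∧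
    ∀ f h : (Fin (L - 1) → ℝ) → ℂ,
      (∀ u ∈ simplex L n, ((∏ i, u i : ℝ) : ℂ) * f u =
        ((∏ i, ratio L n u i : ℝ) : ℂ) * h (ratio L n u)) →
      IntegrableOn h (unitCube L) →
      IntegrableOn f (simplex L n) ∧ ∫ u in simplex L n, f u = κ * ∫ s in unitCube L, h s := by
  have hinj := ratioLog_injective hn
  have hsurj : Function.Surjective (ratioLog L n) := LinearMap.injective_iff_surjective.1 hinj
  set A : (Fin (L - 1) → ℝ) →L[ℝ] (Fin (L - 1) → ℝ) :=
    LinearMap.toContinuousLinearMap (ratioLog L n)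
  have hdet : A.det ≠ 0 := by
    have : IsUnit (ratioLog L n) := (Module.End.isUnit_iff _).2 ⟨hinj, hsurj⟩
    exact (LinearMap.isUnit_det _ this).ne_zero
  have hN : MeasurableSet {z : Fin (L - 1) → ℝ | ∀ i, z i < 0} := by
    rw [ofPred_forall]
    exact MeasurableSet.iInter fun i => measurableSet_lt (measurable_pi_apply i) measurable_const
  have hAN : MeasurableSet (ratioLog L n ⁻¹' {z | ∀ i, z i < 0}) :=
    A.continuous.measurable hN
  refine ⟨|A.det|⁻¹, by positivity, fun f h hfh hh => ?_⟩
  set H : (Fin (L - 1) → ℝ) → ℂ := fun z => (∏ i, Real.exp (z i)) • h fun i => Real.exp (z i)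
  have hF : ∀ v ∈ ratioLog L n ⁻¹' {z | ∀ i, z i < 0},
      ((∏ i, Real.exp (v i)) • f fun i => Real.exp (v i)) = H (A v) := by
    intro v hv
    have := hfh (fun i => Real.exp (v i)) (by rw [simplex_eq_image hn]; exact ⟨v, hv, rfl⟩)
    rw [ratio_exp] at this
    simp only [H, Complex.real_smul]
    exact this
  have hD : ∀ v ∈ ratioLog L n ⁻¹' {z | ∀ i, z i < 0}, HasFDerivWithinAt A A
      (ratioLog L n ⁻¹' {z | ∀ i, z i < 0}) v := fun v _ => A.hasFDerivWithinAt
  have himg : A '' (ratioLog L n ⁻¹' {z | ∀ i, z i < 0}) = {z | ∀ i, z i < 0} :=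
    image_preimage_eq _ hsurj
  have h1 := integrableOn_image_iff_integrableOn_abs_det_fderiv_smul volume hAN hD hinj.injOn H
  have h2 := integral_image_eq_integral_abs_det_fderiv_smul volume hAN hD hinj.injOn H
  rw [himg] at h1 h2
  obtain ⟨e1, e2⟩ := integral_image_exp hN h
  obtain ⟨e3, e4⟩ := integral_image_exp hAN f
  rw [← unitCube_eq_image] at e1 e2
  rw [← simplex_eq_image hn] at e3 e4
  constructor
  · rw [e3, integrableOn_congr_fun hF hAN]
    have := (h1.1 (e1.1 hh)).smul (|A.det|⁻¹)
    refine this.congr (Filter.Eventually.of_forall fun v => ?_)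
    simp only [Pi.smul_apply, smul_smul]
    rw [inv_mul_cancel₀ (abs_ne_zero.2 hdet), one_smul]
  · rw [e4, setIntegral_congr_fun hAN hF, e2, h2, integral_smul, Complex.real_smul, ← mul_assoc,
      ← Complex.ofReal_mul, inv_mul_cancel₀ (abs_ne_zero.2 hdet), Complex.ofReal_one, one_mul]

/-! ### Euler integrals over the unit cube -/

theorem succ_mul_multichoose_succ (c : ℂ) (i : ℕ) :
    (i + 1) * Ring.multichoose c (i + 1) = (c + i) * Ring.multichoose c i := by
  have h : ∀ i : ℕ, (i.factorial : ℂ) * Ring.multichoose c i = (ascPochhammer ℂ i).eval c := by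
    intro i
    rw [← nsmul_eq_mul, Ring.factorial_nsmul_multichoose_eq_ascPochhammer,
      Polynomial.ascPochhammer_smeval_eq_eval]
  have h1 := h (i + 1)
  rw [ascPochhammer_succ_eval, ← h i, Nat.factorial_succ] at h1
  push_cast at h1
  have hf : (i.factorial : ℂ) ≠ 0 := by exact_mod_cast i.factorial_ne_zero
  exact mul_left_cancel₀ hf (by linear_combination h1)

theorem hasSum_one_sub_cpow (c : ℂ) {z : ℂ} (hz : ‖z‖ < 1) :
    HasSum (fun i => Ring.multichoose c i * z ^ i) ((1 - z) ^ (-c)) := by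
  have h := (Complex.one_div_one_sub_cpow_hasFPowerSeriesOnBall_zero c).hasSum (y := z)
    (by simpa [← ofReal_norm] using hz)
  simp only [FormalMultilinearSeries.ofScalars_apply_eq, zero_add, smul_eq_mul, one_div] at h
  rw [Complex.cpow_neg]
  convert! h using 2 with i
  rw [Ring.choose, show c + i - 1 - i + 1 = c by ring]

section Euler

variable {ι : Type*} [Fintype ι]

/-- The integrand of a product of Beta integrals. -/
def betaProd (a b : ι → ℂ) (s : ι → ℝ) : ℂ :=
  ∏ k, ((s k : ℂ) ^ (a k - 1) * (1 - (s k : ℂ)) ^ (b k - 1))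

theorem integrableOn_betaIntegrand {u v : ℂ} (hu : 0 < u.re) (hv : 0 < v.re) :
    IntegrableOn (fun x : ℝ => (x : ℂ) ^ (u - 1) * (1 - (x : ℂ)) ^ (v - 1)) (Ioo 0 1) :=
  ((intervalIntegrable_iff_integrableOn_Ioc_of_le zero_le_one).1
    (Complex.betaIntegral_convergent hu hv)).mono_set Ioo_subset_Ioc_self

theorem integrableOn_betaProd {a b : ι → ℂ} (ha : ∀ k, 0 < (a k).re) (hb : ∀ k, 0 < (b k).re) :
    IntegrableOn (betaProd a b) (univ.pi fun _ => Ioo 0 1) := by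
  rw [IntegrableOn, volume_pi, Measure.restrict_pi_pi]
  exact Integrable.fintype_prod fun k => integrableOn_betaIntegrand (ha k) (hb k)

theorem integral_betaProd (a b : ι → ℂ) :
    ∫ s in univ.pi fun _ => Ioo 0 1, betaProd a b s = ∏ k, Complex.betaIntegral (a k) (b k) := by
  rw [volume_pi, Measure.restrict_pi_pi]
  refine (integral_fintype_prod_eq_prod fun k (x : ℝ) =>
    (x : ℂ) ^ (a k - 1) * (1 - (x : ℂ)) ^ (b k - 1)).trans (Finset.prod_congr rfl fun k _ => ?_)
  rw [Complex.betaIntegral, intervalIntegral.integral_of_le zero_le_one,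
    integral_Ioc_eq_integral_Ioo]

theorem betaProd_add_nat (a b : ι → ℂ) (i : ℕ) {s : ι → ℝ} (hs : ∀ k, 0 < s k) :
    betaProd (fun k => a k + i) b s = (∏ k, s k : ℝ) ^ i * betaProd a b s := by
  rw [betaProd, betaProd, Complex.ofReal_prod, ← Finset.prod_pow, ← Finset.prod_mul_distrib]
  refine Finset.prod_congr rfl fun k _ => ?_
  have : (s k : ℂ) ≠ 0 := by exact_mod_cast (hs k).ne'
  rw [show a k + i - 1 = a k - 1 + i by ring, Complex.cpow_add _ _ this, Complex.cpow_natCast]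
  ring

theorem prod_mem_unit {s : ι → ℝ} (hs : s ∈ univ.pi fun _ => Ioo (0 : ℝ) 1) :
    0 < ∏ k, s k ∧ ∏ k, s k ≤ 1 :=
  ⟨Finset.prod_pos fun k _ => (hs k trivial).1,
    Finset.prod_le_one (fun k _ => (hs k trivial).1.le) fun k _ => (hs k trivial).2.le⟩

theorem norm_mul_prod_le (x : ℂ) {s : ι → ℝ} (hs : s ∈ univ.pi fun _ => Ioo (0 : ℝ) 1) :
    ‖x * (∏ k, s k : ℝ)‖ ≤ ‖x‖ := by
  obtain ⟨h0, h1⟩ := prod_mem_unit hs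
  rw [norm_mul, Complex.norm_real, Real.norm_of_nonneg h0.le]
  exact mul_le_of_le_one_right (norm_nonneg x) h1

/-- Euler's integral for a generalized hypergeometric series, obtained by integrating the binomial
series termwise. -/
theorem euler_integral {a b : ι → ℂ} (ha : ∀ k, 0 < (a k).re) (hb : ∀ k, 0 < (b k).re) (c : ℂ)
    {x : ℂ} (hx : ‖x‖ < 1) :
    IntegrableOn (fun s => betaProd a b s * (1 - x * (∏ k, s k : ℝ)) ^ (-c))
      (univ.pi fun _ => Ioo 0 1) ∧
    HasSum (fun i : ℕ => Ring.multichoose c i * (∏ k, Complex.betaIntegral (a k + i) (b k)) * x ^ i)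
      (∫ s in univ.pi fun _ => Ioo 0 1, betaProd a b s * (1 - x * (∏ k, s k : ℝ)) ^ (-c)) := by
  have hQ : MeasurableSet (univ.pi fun _ : ι => Ioo (0 : ℝ) 1) :=
    MeasurableSet.univ_pi fun _ => measurableSet_Ioo
  have hbase := integrableOn_betaProd ha hb
  set F : ℕ → (ι → ℝ) → ℂ := fun i s =>
    betaProd a b s * (Ring.multichoose c i * (x * (∏ k, s k : ℝ)) ^ i)
  have hsum : Summable fun i => ‖Ring.multichoose c i‖ * ‖x‖ ^ i := by
    have := (hasSum_one_sub_cpow c (z := (‖x‖ : ℂ)) (by simpa using hx)).summable.norm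
    simpa using this
  have hFeq : ∀ i, EqOn (F i) (fun s => (Ring.multichoose c i * x ^ i) *
      betaProd (fun k => a k + i) b s) (univ.pi fun _ => Ioo 0 1) := by
    intro i s hs
    simp only [F, betaProd_add_nat a b i fun k => (hs k trivial).1]
    ring
  have hFint : ∀ i, IntegrableOn (F i) (univ.pi fun _ => Ioo 0 1) := by
    intro i
    rw [integrableOn_congr_fun (hFeq i) hQ]
    refine (integrableOn_betaProd (fun k => ?_) hb).const_mul _
    have := ha k
    simp only [Complex.add_re, Complex.natCast_re]
    positivity
  -- Since `0 < ∏ s_k ≤ 1` on the cube, the binomial series at `‖x‖` dominates.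
  have hFnorm : ∀ i, ∫ s in univ.pi fun _ => Ioo 0 1, ‖F i s‖ ≤
      (∫ s in univ.pi fun _ => Ioo 0 1, ‖betaProd a b s‖) *
        (‖Ring.multichoose c i‖ * ‖x‖ ^ i) := by
    intro i
    rw [← integral_mul_const]
    refine setIntegral_mono_on (hFint i).norm (hbase.norm.mul_const _) hQ fun s hs => ?_
    rw [norm_mul, norm_mul, norm_pow]
    gcongr
    exact norm_mul_prod_le x hs
  have hFsum : Summable fun i => ∫ s in univ.pi fun _ => Ioo 0 1, ‖F i s‖ :=
    .of_nonneg_of_le (fun i => integral_nonneg fun s => norm_nonneg _) hFnorm (hsum.mul_left _)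
  have hts : EqOn (fun s => ∑' i, F i s)
      (fun s => betaProd a b s * (1 - x * (∏ k, s k : ℝ)) ^ (-c)) (univ.pi fun _ => Ioo 0 1) := by
    intro s hs
    exact ((hasSum_one_sub_cpow c ((norm_mul_prod_le x hs).trans_lt hx)).mul_left _).tsum_eq
  constructor
  · refine Integrable.mul_bdd (c := ∑' i, ‖Ring.multichoose c i‖ * ‖x‖ ^ i) hbase ?_ ?_
    · refine ContinuousOn.aestronglyMeasurable (fun s hs => ?_) hQ
      refine ContinuousAt.continuousWithinAt (ContinuousAt.cpow (by fun_prop) continuousAt_const ?_)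
      have := (norm_mul_prod_le x hs).trans_lt hx
      rw [sub_eq_add_neg]
      exact Complex.mem_slitPlane_of_norm_lt_one (by rwa [norm_neg])
    · refine (ae_restrict_iff' hQ).2 (Filter.Eventually.of_forall fun s hs => ?_)
      have h1 := norm_mul_prod_le x hs
      rw [← (hasSum_one_sub_cpow c (h1.trans_lt hx)).tsum_eq]
      refine tsum_of_norm_bounded hsum.hasSum fun i => ?_
      rw [norm_mul, norm_pow]
      gcongr
  · rw [← setIntegral_congr_fun hQ hts]
    convert! hasSum_integral_of_summable_integral_norm hFint hFsum using 2 with i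
    rw [setIntegral_congr_fun hQ (hFeq i), integral_const_mul, integral_betaProd]
    ring

end Euler

/-! ### The Euler integrals of the local solutions -/

/-- The exponent `α_{n+k} - γ_n` of `s_k`, for `k = i + 1`. -/
def leftExp (p : Params L) (n : ℕ) (i : Fin (L - 1)) : ℂ := p.alpha (n + i + 1) - p.gamma n

/-- The exponent `γ_{n+k} - α_{n+k}` of `1 - s_k`, for `k = i + 1`. -/
def rightExp (p : Params L) (n : ℕ) (i : Fin (L - 1)) : ℂ :=
  p.gamma (n + i + 1) - p.alpha (n + i + 1)

/-- The product of the Beta functions `B(α_{n+k} - γ_n, γ_{n+k} - α_{n+k})`, `1 ≤ k ≤ L - 1`, in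
its meromorphic continuation. -/
def gammaConst (p : Params L) (n : ℕ) : ℂ :=
  ∏ i : Fin (L - 1), Complex.Gamma (leftExp p n i) * Complex.Gamma (rightExp p n i) *
    (Complex.Gamma (p.gamma (n + i + 1) - p.gamma n))⁻¹

theorem beta_add_one_left {u v : ℂ} (hu : 0 < u.re) (hv : 0 < v.re) :
    (u + v) * Complex.betaIntegral (u + 1) v = u * Complex.betaIntegral u v := by
  have h1 : u ≠ 0 := fun h => by simp [h] at hu
  have h2 : u + v ≠ 0 := fun h => by
    have := congrArg Complex.re h; simp at this; linarith
  have h3 : Complex.Gamma (u + v) ≠ 0 :=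
    Complex.Gamma_ne_zero_of_re_pos (by simp; linarith)
  have h4 : u + 1 + v = u + v + 1 := by ring
  rw [Complex.betaIntegral_eq_Gamma_mul_div _ _ hu hv,
    Complex.betaIntegral_eq_Gamma_mul_div _ _ (by simp; linarith) hv, h4,
    Complex.Gamma_add_one _ h1, Complex.Gamma_add_one _ h2]
  field_simp

theorem beta_add_one_right {u v : ℂ} (hu : 0 < u.re) (hv : 0 < v.re) :
    (u + v) * Complex.betaIntegral u (v + 1) = v * Complex.betaIntegral u v := by
  rw [Complex.betaIntegral_symm v u, Complex.betaIntegral_symm (v + 1) u, add_comm u v]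
  exact beta_add_one_left hv hu

theorem re_leftExp_pos {p : Params L} {n : ℕ} (hp : p ∈ convergent L n) (i : Fin (L - 1)) :
    0 < (leftExp p n i).re := by
  have := (hp (i + 1) (Finset.mem_Icc.2 ⟨by omega, i.2⟩)).1
  rw [leftExp, Complex.sub_re]
  exact sub_pos.2 this

theorem re_rightExp_pos {p : Params L} {n : ℕ} (hp : p ∈ convergent L n) (i : Fin (L - 1)) :
    0 < (rightExp p n i).re := by
  have := (hp (i + 1) (Finset.mem_Icc.2 ⟨by omega, i.2⟩)).2
  rw [rightExp, Complex.sub_re]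
  exact sub_pos.2 this

theorem nonResonant_of_forall {p : Params L} {n : ℕ}
    (h : ∀ k ∈ Finset.Icc 1 (L - 1), ∀ j : ℕ, p.gamma (n + k) - p.gamma n ≠ -(j : ℂ))
    (hL : 0 < L) : NonResonant p n := by
  intro N hN
  obtain ⟨d, rfl⟩ := Nat.exists_eq_add_of_lt hN
  have hd : n + d + 1 = n + (d + 1) % L + (d + 1) / L * L := by
    have := Nat.mod_add_div' (d + 1) L
    omega
  rw [hd, gamma_add_mul hL]
  by_cases hk : (d + 1) % L = 0
  · rw [hk, add_zero, add_sub_cancel_left, Nat.cast_ne_zero]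
    intro h0
    have := Nat.mod_add_div' (d + 1) L
    rw [hk, h0] at this
    omega
  · have hlt := Nat.mod_lt (d + 1) hL
    have := h ((d + 1) % L) (Finset.mem_Icc.2 ⟨by omega, by omega⟩) ((d + 1) / L)
    intro h0
    exact this (by linear_combination h0)

theorem nonResonant_of_mem_convergent {p : Params L} {n : ℕ} (hL : 0 < L)
    (hp : p ∈ convergent L n) : NonResonant p n := by
  refine nonResonant_of_forall (fun k hk j h => ?_) hL
  have h1 := hp k hk
  have h2 := congrArg Complex.re h
  simp only [Complex.sub_re, Complex.neg_re, Complex.natCast_re] at h2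
  have : (0 : ℝ) ≤ j := j.cast_nonneg
  linarith

theorem gammaConst_eq_prod_beta {p : Params L} {n : ℕ} (hp : p ∈ convergent L n) :
    gammaConst p n = ∏ i, Complex.betaIntegral (leftExp p n i) (rightExp p n i) := by
  refine Finset.prod_congr rfl fun i _ => ?_
  rw [Complex.betaIntegral_eq_Gamma_mul_div _ _ (re_leftExp_pos hp i) (re_rightExp_pos hp i),
    div_eq_mul_inv]
  congr 3
  rw [leftExp, rightExp]
  ring

theorem re_add_nat_pos {u : ℂ} (hu : 0 < u.re) (q : ℕ) : 0 < (u + q).re := by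
  simp only [Complex.add_re, Complex.natCast_re]
  positivity

/-- The product of Beta functions, the first `j` of them shifted by `q + 1` and the others
by `q`. -/
def shiftedBeta (p : Params L) (n j q : ℕ) : ℂ :=
  ∏ i : Fin (L - 1), Complex.betaIntegral
    (leftExp p n i + (q + if (i : ℕ) < j then 1 else 0 : ℕ)) (rightExp p n i)

theorem shiftedBeta_last (p : Params L) (n q : ℕ) :
    shiftedBeta p n (L - 1) q = shiftedBeta p n 0 (q + 1) := by
  refine Finset.prod_congr rfl fun i _ => ?_
  simp

/-- Replacing the factor number `j` in a product of Beta functions. -/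
theorem prod_update_eq {ι : Type*} [Fintype ι] {f g : ι → ℂ} (j : ι) (h : ∀ i, i ≠ j → f i = g i)
    {c d : ℂ} (hj : c * f j = d * g j) : c * ∏ i, f i = d * ∏ i, g i := by
  classical
  rw [← Finset.mul_prod_erase _ f (Finset.mem_univ j),
    ← Finset.mul_prod_erase _ g (Finset.mem_univ j),
    ← mul_assoc, hj, mul_assoc]
  congr 2
  exact Finset.prod_congr rfl fun i hi => h i (Finset.ne_of_mem_erase hi)

theorem shiftedBeta_succ {p : Params L} {n : ℕ} (hp : p ∈ convergent L n) {j : ℕ}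
    (hj : j < L - 1) (q : ℕ) :
    (p.gamma (n + j + 1) + q - p.gamma n) * shiftedBeta p n (j + 1) q =
      (p.alpha (n + j + 1) + q - p.gamma n) * shiftedBeta p n j q := by
  refine prod_update_eq ⟨j, hj⟩ (fun i hi => ?_) ?_
  · have : (i : ℕ) ≠ j := fun h => hi (Fin.ext h)
    have h2 : (i : ℕ) < j + 1 ↔ (i : ℕ) < j := by omega
    simp only [h2]
  · have := beta_add_one_left (re_add_nat_pos (re_leftExp_pos hp ⟨j, hj⟩) q)
      (re_rightExp_pos hp ⟨j, hj⟩)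
    simp only [leftExp, rightExp, Nat.lt_succ_self, lt_irrefl, if_true, if_false] at this ⊢
    push_cast
    rw [show p.alpha (n + j + 1) - p.gamma n + (q + 1) = p.alpha (n + j + 1) - p.gamma n + q + 1
      by ring, add_zero]
    linear_combination this

/-- The coefficients `e(N)` are products of Beta functions: both sides satisfy the same recurrence.
A step from `j` to `j + 1` shifts one Beta factor; the step from `(L - 1, q)` to `(0, q + 1)`, at
the index `N ≡ n`, changes the binomial coefficient only. -/
theorem shiftedBeta_eq_frob {p : Params L} {n : ℕ} (hp : p ∈ convergent L n) (hL : 0 < L) (q : ℕ) :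
    ∀ j ≤ L - 1, Ring.multichoose (p.alpha n - p.gamma n + 1) q * shiftedBeta p n j q =
      gammaConst p n * frob p n (n + 1 + j + q * L) := by
  have hres := nonResonant_of_mem_convergent hL hp
  induction q with
  | zero =>
    intro j
    induction j with
    | zero =>
      intro _
      rw [gammaConst_eq_prod_beta hp]
      simp [shiftedBeta, frob_self_succ]
    | succ j ih =>
      intro hj
      have h1 := ih (by omega)
      have h2 := shiftedBeta_succ hp (show j < L - 1 by omega) 0
      have h3 := frob_recurrence hres (n + 1 + j)
      have h4 := hres (n + j + 1) (by omega)
      rw [show n + 1 + j = n + j + 1 by ring, zero_mul, add_zero] at *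
      rw [show n + 1 + (j + 1) = n + j + 1 + 1 by ring]
      simp only [Nat.cast_zero, add_zero] at h2
      refine mul_left_cancel₀ h4 ?_
      linear_combination (Ring.multichoose (p.alpha n - p.gamma n + 1) 0) * h2 +
        (p.alpha (n + j + 1) - p.gamma n) * h1 - gammaConst p n * h3
  | succ q ihq =>
    intro j
    induction j with
    | zero =>
      intro _
      have h1 := ihq (L - 1) le_rfl
      rw [shiftedBeta_last] at h1
      have h2 := succ_mul_multichoose_succ (p.alpha n - p.gamma n + 1) q
      have h3 := frob_recurrence hres (n + (q + 1) * L)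
      rw [gamma_add_mul hL, alpha_add_mul hL] at h3
      have h4 : ((q + 1 : ℕ) : ℂ) ≠ 0 := by exact_mod_cast q.succ_ne_zero
      have h5 : n + 1 + (L - 1) + q * L = n + (q + 1) * L := by
        rw [add_mul, one_mul]; omega
      rw [h5] at h1
      rw [show n + 1 + 0 + (q + 1) * L = n + (q + 1) * L + 1 by ring]
      refine mul_left_cancel₀ h4 ?_
      push_cast at h3 ⊢
      linear_combination shiftedBeta p n 0 (q + 1) * h2 + (p.alpha n - p.gamma n + 1 + q) * h1
        - gammaConst p n * h3
    | succ j ih =>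
      intro hj
      have h1 := ih (by omega)
      have h2 := shiftedBeta_succ hp (show j < L - 1 by omega) (q + 1)
      have h3 := frob_recurrence hres (n + j + 1 + (q + 1) * L)
      have h4 := hres (n + j + 1 + (q + 1) * L) (by
        have : 0 ≤ (q + 1) * L := Nat.zero_le _
        omega)
      rw [gamma_add_mul hL] at h3 h4
      rw [alpha_add_mul hL] at h3
      rw [show n + 1 + j + (q + 1) * L = n + j + 1 + (q + 1) * L by ring] at h1
      rw [show n + 1 + (j + 1) + (q + 1) * L = n + j + 1 + (q + 1) * L + 1 by ring]
      refine mul_left_cancel₀ h4 ?_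
      linear_combination (Ring.multichoose (p.alpha n - p.gamma n + 1) (q + 1)) * h2 +
        (p.alpha (n + j + 1) + (q + 1 : ℕ) - p.gamma n) * h1 - gammaConst p n * h3

/-- The exponents of `s_k` after division by all the factors `τ_{n+k-1} - τ_{n+k}` but the one with
`k = j`. -/
def shiftLeft (p : Params L) (n j : ℕ) (i : Fin (L - 1)) : ℂ :=
  leftExp p n i + if (i : ℕ) + 1 < j then 1 else 0

/-- The exponents of `1 - s_k` after division by all the factors `τ_{n+k-1} - τ_{n+k}` but the one
with `k = j`. -/
def shiftRight (p : Params L) (n j : ℕ) (i : Fin (L - 1)) : ℂ :=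
  rightExp p n i + if (i : ℕ) + 1 = j then 1 else 0

/-- The exponent of `1 / (1 - x s_1 ⋯ s_{L-1})` after division by all the factors
`τ_{n+k-1} - τ_{n+k}` but the one with `k = j`; the factor with `k = 0` is the one which is
proportional to `1 - x s_1 ⋯ s_{L-1}`. -/
def shiftX (p : Params L) (n j : ℕ) : ℂ := p.alpha n - p.gamma n + if j = 0 then 0 else 1

theorem re_shiftLeft_pos {p : Params L} {n : ℕ} (hp : p ∈ convergent L n) (j : ℕ)
    (i : Fin (L - 1)) : 0 < (shiftLeft p n j i).re := by
  have := re_leftExp_pos hp i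
  rw [shiftLeft]
  split_ifs
  · simp; linarith
  · simpa

theorem re_shiftRight_pos {p : Params L} {n : ℕ} (hp : p ∈ convergent L n) (j : ℕ)
    (i : Fin (L - 1)) : 0 < (shiftRight p n j i).re := by
  have := re_rightExp_pos hp i
  rw [shiftRight]
  split_ifs
  · simp; linarith
  · simpa

/-- The coefficients of the Euler integrals are the differences `e(N + 1) - e(N)`. -/
theorem euler_coeff {p : Params L} {n : ℕ} (hp : p ∈ convergent L n) {j : ℕ}
    (hj : j < L) (q : ℕ) :
    Ring.multichoose (shiftX p n j) q *
        ∏ i, Complex.betaIntegral (shiftLeft p n j i + q) (shiftRight p n j i) =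
      (if j = 0 then 1 else -1) * gammaConst p n *
        (frob p n (n + j + 1 + q * L) - frob p n (n + j + q * L)) := by
  have hL : 0 < L := by omega
  have hres := nonResonant_of_mem_convergent hL hp
  have hW := shiftedBeta_eq_frob hp hL
  rcases j with _ | j
  · have hprod : ∏ i, Complex.betaIntegral (shiftLeft p n 0 i + q) (shiftRight p n 0 i)
        = shiftedBeta p n 0 q := by
      refine Finset.prod_congr rfl fun i _ => ?_
      simp [shiftLeft, shiftRight]
    rw [hprod, shiftX, if_pos rfl, if_pos rfl, add_zero, one_mul, mul_sub]
    have h1 := hW q 0 (Nat.zero_le _)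
    rw [show n + 0 + 1 + q * L = n + 1 + 0 + q * L by ring, ← h1]
    rcases q with _ | q
    · rw [frob_of_le p (by simp)]
      simp
    · have h2 := hW q (L - 1) le_rfl
      have h5 : n + 1 + (L - 1) + q * L = n + 0 + (q + 1) * L := by
        rw [add_mul, one_mul]; omega
      rw [h5, shiftedBeta_last] at h2
      -- Pascal's rule also covers the case of an integer `α_n - γ_n ≤ 0`.
      rw [← h2, Ring.multichoose_succ_succ]
      ring
  · have hj' : j < L - 1 := by omega
    have hprod : (p.gamma (n + j + 1) + q - p.gamma n) *
        ∏ i, Complex.betaIntegral (shiftLeft p n (j + 1) i + q) (shiftRight p n (j + 1) i)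
        = (p.gamma (n + j + 1) - p.alpha (n + j + 1)) * shiftedBeta p n j q := by
      refine prod_update_eq ⟨j, hj'⟩ (fun i hi => ?_) ?_
      · have h1 : (i : ℕ) ≠ j := fun h => hi (Fin.ext h)
        rw [shiftLeft, shiftRight, if_neg (show ¬ (i : ℕ) + 1 = j + 1 by omega), add_zero]
        simp only [add_lt_add_iff_right]
        congr 1
        push_cast
        ring
      · have := beta_add_one_right (re_add_nat_pos (re_leftExp_pos hp ⟨j, hj'⟩) q)
          (re_rightExp_pos hp ⟨j, hj'⟩)
        simp only [shiftLeft, shiftRight, leftExp, rightExp, lt_irrefl, if_true, if_false,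
          add_zero] at this ⊢
        linear_combination this
    have h4 := hres (n + j + 1 + q * L) (by
      have : 0 ≤ q * L := Nat.zero_le _
      omega)
    have h3 := frob_recurrence hres (n + j + 1 + q * L)
    rw [gamma_add_mul hL] at h3 h4
    rw [alpha_add_mul hL] at h3
    have h1 := hW q j (by omega)
    rw [show n + 1 + j + q * L = n + j + 1 + q * L by ring] at h1
    rw [show n + (j + 1) + 1 + q * L = n + j + 1 + q * L + 1 by ring,
      show n + (j + 1) + q * L = n + j + 1 + q * L by ring, shiftX, if_neg (Nat.succ_ne_zero j),
      if_neg (Nat.succ_ne_zero j)]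
    refine mul_left_cancel₀ h4 ?_
    linear_combination (Ring.multichoose (p.alpha n - p.gamma n + 1) q) * hprod +
      (p.gamma (n + j + 1) - p.alpha (n + j + 1)) * h1 + gammaConst p n * h3

/-- The integrals of the local solutions over the unit cube. -/
theorem euler_integral_eq {p : Params L} {n : ℕ} (hn : n < L) (hp : p ∈ convergent L n) {j : ℕ}
    (hj : j < L) {x : ℂ} (hx : ‖x‖ < 1) :
    ∫ s in unitCube L, betaProd (shiftLeft p n j) (shiftRight p n j) s *
        (1 - x * (∏ k, s k : ℝ)) ^ (-shiftX p n j) =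
      (if j = 0 then 1 else -1) * gammaConst p n *
        (frobSeries p n (n + j + 1) x - frobSeries p n (n + j) x) := by
  have hres := nonResonant_of_mem_convergent (by omega) hp
  have h1 := (euler_integral (re_shiftLeft_pos hp j) (re_shiftRight_pos hp j) (shiftX p n j) hx).2
  have hx' : x ∈ Metric.ball (0 : ℂ) 1 := by simpa using hx
  have hs : ∀ m, HasSum (fun i : ℕ => frob p n (m + i * L) * x ^ i) (frobSeries p n m x) := fun m =>
    ((powerSeries_unit_disc fun _ => summable_frob hn hres m).2.1 x hx').hasSum
  refine h1.unique ?_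
  convert! ((hs (n + j + 1)).sub (hs (n + j))).mul_left
    ((if j = 0 then 1 else -1) * gammaConst p n) using 2 with q
  rw [euler_coeff hp hj]
  ring

/-! ### Branches along the simplices -/

/-- Two continuous logarithms of proportional functions on a connected set differ by a constant. -/
theorem exists_log_eq_add_const {X : Type*} [TopologicalSpace X] {S : Set X}
    (hS : IsPreconnected S) {f g : X → ℂ} (hf : ContinuousOn f S) (hg : ContinuousOn g S) {ε : ℂ}
    (hε : ε ≠ 0) (h : ∀ x ∈ S, Complex.exp (f x) = ε * Complex.exp (g x)) :
    ∃ c, Complex.exp c = ε ∧ ∀ x ∈ S, f x = g x + c := by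
  rcases S.eq_empty_or_nonempty with rfl | ⟨x₀, hx₀⟩
  · exact ⟨Complex.log ε, Complex.exp_log hε, by simp⟩
  · have he : ∀ x ∈ S, Complex.exp (f x - g x) = ε := fun x hx => by
      rw [Complex.exp_sub, h x hx, mul_div_cancel_right₀ _ (Complex.exp_ne_zero _)]
    refine ⟨f x₀ - g x₀, he x₀ hx₀, fun x hx => ?_⟩
    have := Complex.isCoveringMap_exp.constOn_of_comp hS (hf.sub hg)
      (fun a ha a' ha' => Subtype.ext ((he a ha).trans (he a' ha').symm)) hx hx₀
    rw [Pi.sub_apply, Pi.sub_apply] at this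
    rw [← this, add_sub_cancel]

theorem rseq_convex_comb (u v : Fin (L - 1) → ℝ) {a b : ℝ} (hab : a + b = 1) (j : ℕ) :
    rseq L (a • u + b • v) j = a * rseq L u j + b * rseq L v j := by
  unfold rseq coord
  split_ifs
  · simp
  · rw [mul_one, mul_one, hab]

theorem convex_simplex (n : ℕ) : Convex ℝ (simplex L n) := by
  intro u hu v hv a b ha hb hab
  have key : ∀ x y x' y' : ℝ, x < y → x' < y' → a * x + b * x' < a * y + b * y' := by
    intro x y x' y' h h'
    rcases ha.eq_or_lt with rfl | ha
    · rw [zero_add] at hab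
      subst hab
      linarith
    · have := mul_lt_mul_of_pos_left h ha
      have := mul_le_mul_of_nonneg_left h'.le hb
      linarith
  refine ⟨?_, fun j hj hjL => ?_⟩
  · rw [rseq_convex_comb u v hab]
    simpa using key _ _ _ _ hu.1 hv.1
  · rw [rseq_convex_comb u v hab, rseq_convex_comb u v hab]
    exact key _ _ _ _ (hu.2 j hj hjL) (hv.2 j hj hjL)

theorem isPreconnected_domain (n : ℕ) : IsPreconnected (cover ×ˢ simplex L n) :=
  (convex_cover.prod (convex_simplex n)).isPreconnected

theorem continuous_rseq (j : ℕ) : Continuous fun u : Fin (L - 1) → ℝ => rseq L u j := by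
  unfold rseq coord
  split_ifs <;> fun_prop

theorem prod_ratio {n : ℕ} (hn : n < L) {u : Fin (L - 1) → ℝ} (hu : u ∈ simplex L n) :
    ∏ i, ratio L n u i = rseq L u (n + L - 1) / rseq L u n := by
  simp only [ratio]
  rw [Fin.prod_univ_eq_prod_range (fun i => rseq L u (n + i + 1) / rseq L u (n + i)) (L - 1)]
  have := Finset.prod_range_div
    (fun i => Units.mk0 (rseq L u (n + i)) (rseq_pos hn hu _).ne') (L - 1)
  have := congrArg Units.val this
  simp only [Units.coe_prod, Units.val_div_eq_div_val, Units.val_mk0, add_zero] at this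
  rw [Nat.add_sub_assoc (by omega)]
  exact this

/-- The difference `r_{k-1} - r_k` is positive, except for `k ≡ n`. -/
theorem rseq_sub_pos {n : ℕ} (hn : n < L) {u : Fin (L - 1) → ℝ} (hu : u ∈ simplex L n) {k : ℕ}
    (hk : k % L ≠ n) : 0 < rseq L u (k + L - 1) - rseq L u k := by
  obtain ⟨d, hd, hdk⟩ := exists_rseq_eq hn k
  have hd0 : d ≠ 0 := by
    rintro rfl
    rw [add_zero, Nat.mod_eq_of_lt hn] at hdk
    exact hk hdk.symm
  have h1 := hu.2 (n + d - 1) (by omega) (by omega)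
  have h2 : rseq L u (n + d - 1 + 1) = rseq L u k := by
    rw [rseq, rseq, show n + d - 1 + 1 = n + d by omega, hdk]
  have h3 : rseq L u (n + d - 1) = rseq L u (k + L - 1) := by
    rw [← rseq_add]
    have : (n + d - 1 + L) % L = (k + L - 1) % L := by
      have : n + d + (L - 1) ≡ k + (L - 1) [MOD L] := Nat.ModEq.add_right _ hdk
      rw [show n + d - 1 + L = n + d + (L - 1) by omega, Nat.add_sub_assoc (by omega)]
      exact this
    rw [rseq, rseq, this]
  rw [← h2, ← h3]
  exact sub_pos.2 h1

/-- The real logarithm of `r_k`. -/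
def logR (L : ℕ) (u : Fin (L - 1) → ℝ) (k : ℕ) : ℂ := (Real.log (rseq L u k) : ℂ)

/-- The principal logarithm of `1 - x s_1 ⋯ s_{L-1}`. -/
def logOneSub (L n : ℕ) (w : ℂ) (u : Fin (L - 1) → ℝ) : ℂ :=
  Complex.log (1 - Complex.exp w * (∏ i, ratio L n u i : ℝ))

/-- A logarithm of `±(τ_{k-1} - τ_k)`, up to the contribution of the common factor of `τ_{k-1}`
and `τ_k`, periodic in `k`. For `k ≡ n` the two variables lie at the two ends of the chain that
defines `Δ_n`, and the difference is `± r_n (1 - x s_1 ⋯ s_{L-1})`. -/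
def logDiff (L n : ℕ) (w : ℂ) (u : Fin (L - 1) → ℝ) (k : ℕ) : ℂ :=
  if k % L = n then logR L u n + logOneSub L n w u
  else (Real.log (rseq L u (k + L - 1) - rseq L u k) : ℂ)

theorem one_sub_mem_slitPlane {n : ℕ} (hn : n < L) {w : ℂ} (hw : w ∈ cover)
    {u : Fin (L - 1) → ℝ} (hu : u ∈ simplex L n) :
    1 - Complex.exp w * (∏ i, ratio L n u i : ℝ) ∈ Complex.slitPlane := by
  have := (norm_mul_prod_le (Complex.exp w) (ratio_mem_unitCube hn hu)).trans_lt
    (norm_exp_lt_one hw)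
  rw [sub_eq_add_neg]
  exact Complex.mem_slitPlane_of_norm_lt_one (by rwa [norm_neg])

theorem exp_logR {n : ℕ} (hn : n < L) {u : Fin (L - 1) → ℝ} (hu : u ∈ simplex L n) (k : ℕ) :
    Complex.exp (logR L u k) = rseq L u k := by
  rw [logR, ← Complex.ofReal_exp, Real.exp_log (rseq_pos hn hu k)]

theorem exp_logDiff_of_ne {n : ℕ} (hn : n < L) (w : ℂ) {u : Fin (L - 1) → ℝ}
    (hu : u ∈ simplex L n) {k : ℕ} (hk : k % L ≠ n) :
    Complex.exp (logDiff L n w u k) = rseq L u (k + L - 1) - rseq L u k := by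
  rw [logDiff, if_neg hk, ← Complex.ofReal_exp, Real.exp_log (rseq_sub_pos hn hu hk),
    Complex.ofReal_sub]

theorem exp_logDiff_of_eq {n : ℕ} (hn : n < L) {w : ℂ} (hw : w ∈ cover) {u : Fin (L - 1) → ℝ}
    (hu : u ∈ simplex L n) {k : ℕ} (hk : k % L = n) :
    Complex.exp (logDiff L n w u k) = rseq L u n - Complex.exp w * rseq L u (n + L - 1) := by
  have h0 : (rseq L u n : ℂ) ≠ 0 := by exact_mod_cast (rseq_pos hn hu n).ne'
  rw [logDiff, if_pos hk, Complex.exp_add, exp_logR hn hu, logOneSub,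
    Complex.exp_log (Complex.slitPlane_ne_zero (one_sub_mem_slitPlane hn hw hu)), prod_ratio hn hu]
  push_cast
  field_simp

theorem continuousOn_logR {n : ℕ} (hn : n < L) (k : ℕ) :
    ContinuousOn (fun q : ℂ × (Fin (L - 1) → ℝ) => logR L q.2 k) (cover ×ˢ simplex L n) := by
  refine Complex.continuous_ofReal.comp_continuousOn (ContinuousOn.log
    ((continuous_rseq k).comp continuous_snd).continuousOn fun q hq => (rseq_pos hn hq.2 k).ne')

theorem continuousOn_logDiff {n : ℕ} (hn : n < L) (k : ℕ) :
    ContinuousOn (fun q : ℂ × (Fin (L - 1) → ℝ) => logDiff L n q.1 q.2 k)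
      (cover ×ˢ simplex L n) := by
  unfold logDiff
  split_ifs with hk
  · refine (continuousOn_logR hn n).add (ContinuousOn.clog ?_ fun q hq =>
      one_sub_mem_slitPlane hn hq.1 hq.2)
    refine continuousOn_const.sub (ContinuousOn.mul (by fun_prop) ?_)
    refine Complex.continuous_ofReal.comp_continuousOn (continuousOn_finsetProd _ fun i _ => ?_)
    exact ((continuous_rseq _).comp continuous_snd).continuousOn.div
      ((continuous_rseq _).comp continuous_snd).continuousOn fun q hq => (rseq_pos hn hq.2 _).ne'
  · refine Complex.continuous_ofReal.comp_continuousOn (ContinuousOn.log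
      (((continuous_rseq _).comp continuous_snd).sub
        ((continuous_rseq _).comp continuous_snd)).continuousOn
      fun q hq => (rseq_sub_pos hn hq.2 hk).ne')

/-- The exponent of `1 / x` in `t_k` on `Δ_n`. -/
def xExp (n k : ℕ) : ℂ := if n ≠ 0 ∧ n ≤ k then 1 else 0

theorem point_eq (n : ℕ) (w : ℂ) (u : Fin (L - 1) → ℝ) (k : ℕ) :
    point L n (Complex.exp w) u k = rseq L u k * Complex.exp (-(xExp n k * w)) := by
  unfold point xExp
  split_ifs
  · rw [one_mul, Complex.exp_neg, div_eq_mul_inv]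
  · simp

namespace Branch

variable {n : ℕ} (B : Branch L n)

theorem exists_logT_eq (hn : n < L) {k : ℕ} (hk : k ∈ Finset.Icc 1 (L - 1)) :
    ∃ c, Complex.exp c = 1 ∧ ∀ w ∈ cover, ∀ u ∈ simplex L n,
      B.logT k w u = logR L u k - xExp n k * w + c := by
  obtain ⟨c, hc, h⟩ := exists_log_eq_add_const (isPreconnected_domain n)
    (B.continuousOn_logT k hk) (g := fun q => logR L q.2 k - xExp n k * q.1)
    ((continuousOn_logR hn k).sub (by fun_prop)) one_ne_zero fun q hq => by
    rw [B.exp_logT k hk q.1 hq.1 q.2 hq.2, point_eq, one_mul, sub_eq_add_neg, Complex.exp_add,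
      exp_logR hn hq.2]
  exact ⟨c, hc, fun w hw u hu => h (w, u) ⟨hw, hu⟩⟩

theorem exists_logD_eq (hn : n < L) {k : ℕ} (hk : k ∈ Finset.Icc 1 (L - 1)) :
    ∃ c, Complex.exp c = (if k = n then -1 else 1) ∧ ∀ w ∈ cover, ∀ u ∈ simplex L n,
      B.logD k w u = logDiff L n w u k - xExp n k * w + c := by
  obtain ⟨hk1, hkL⟩ := Finset.mem_Icc.1 hk
  have hmod : k % L = k := Nat.mod_eq_of_lt (by omega)
  obtain ⟨c, hc, h⟩ := exists_log_eq_add_const (isPreconnected_domain n)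
    (B.continuousOn_logD k hk) (g := fun q => logDiff L n q.1 q.2 k - xExp n k * q.1)
    ((continuousOn_logDiff hn k).sub (by fun_prop)) (ε := if k = n then -1 else 1)
      (by split_ifs <;> simp) fun q hq => by
    have hpred : rseq L q.2 (k + L - 1) = rseq L q.2 (k - 1) := by
      rw [show k + L - 1 = k - 1 + L by omega, rseq_add]
    rw [B.exp_logD k hk q.1 hq.1 q.2 hq.2, point_eq, point_eq, sub_eq_add_neg (logDiff _ _ _ _ _),
      Complex.exp_add]
    split_ifs with hkn
    · rw [exp_logDiff_of_eq hn hq.1 hq.2 (hmod.trans hkn), ← hkn, hpred]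
      have h1 : xExp k (k - 1) = 0 := if_neg (by omega)
      have h2 : xExp k k = 1 := if_pos (by omega)
      have h3 : Complex.exp (-q.1) * Complex.exp q.1 = 1 := by rw [← Complex.exp_add]; simp
      rw [h1, h2, one_mul, zero_mul, neg_zero, Complex.exp_zero, mul_one]
      linear_combination (-rseq L q.2 (k - 1) : ℂ) * h3
    · rw [exp_logDiff_of_ne hn q.1 hq.2 (by rwa [hmod]), hpred]
      have h1 : xExp n (k - 1) = xExp n k := by
        have : (n ≠ 0 ∧ n ≤ k - 1) ↔ (n ≠ 0 ∧ n ≤ k) := by omega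
        simp only [xExp, this]
      rw [h1]
      ring
  exact ⟨c, hc, fun w hw u hu => h (w, u) ⟨hw, hu⟩⟩

theorem exists_logX_eq (hn : n < L) (hL : 2 ≤ L) :
    ∃ c, Complex.exp c = (if n = 0 then 1 else -1) ∧ ∀ w ∈ cover, ∀ u ∈ simplex L n,
      B.logX w u = logDiff L n w u L + c := by
  obtain ⟨c, hc, h⟩ := exists_log_eq_add_const (isPreconnected_domain n)
    B.continuousOn_logX (continuousOn_logDiff hn L) (ε := if n = 0 then 1 else -1)
      (by split_ifs <;> simp) fun q hq => by
    rw [B.exp_logX q.1 hq.1 q.2 hq.2, point_eq]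
    split_ifs with h0
    · subst h0
      have h1 : xExp 0 (L - 1) = 0 := if_neg (by omega)
      have h2 : rseq L q.2 0 = 1 := by simpa using rseq_mul q.2 0
      rw [exp_logDiff_of_eq hn hq.1 hq.2 (Nat.mod_self L), h1, h2, zero_add]
      simp
    · have h1 : xExp n (L - 1) = 1 := if_pos ⟨h0, by omega⟩
      have h2 : rseq L q.2 (L + L - 1) = rseq L q.2 (L - 1) := by
        rw [show L + L - 1 = L - 1 + L by omega, rseq_add]
      rw [exp_logDiff_of_ne hn q.1 hq.2 (by rw [Nat.mod_self]; exact Ne.symm h0), h1, h2, rseq_self,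
        one_mul, Complex.exp_neg]
      have := Complex.exp_ne_zero q.1
      field_simp
      push_cast
      ring
  exact ⟨c, hc, fun w hw u hu => h (w, u) ⟨hw, hu⟩⟩

end Branch

/-! ### The integrand in multiplicative coordinates -/

theorem sum_range_add_of_periodic {G : ℕ → ℂ} (hG : ∀ k, G (k + L) = G k) (n : ℕ) :
    ∑ k ∈ Finset.range L, G (n + k) = ∑ k ∈ Finset.range L, G k := by
  induction n with
  | zero => simp
  | succ n ih =>
    rw [← ih]
    have h1 := Finset.sum_range_succ (fun k => G (n + k)) L
    have h2 := Finset.sum_range_succ' (fun k => G (n + k)) L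
    rw [h1, hG, add_zero] at h2
    have h3 := add_right_cancel h2
    rw [h3]
    exact Finset.sum_congr rfl fun k _ => by rw [add_right_comm, add_assoc]

/-- Summation by parts: the exponents of the variables `τ_{n+i} = exp l_i` turn into the exponents
of the ratios of consecutive variables. -/
theorem sum_exponents_eq (al ga l : ℕ → ℂ) (j N : ℕ) :
    ∑ i ∈ Finset.range N, ((al (i + 1) - ga (i + 2) + 1) * l (i + 1) +
        (ga (i + 1) - al (i + 1) - if i + 1 = j then 0 else 1) * l i) =
      ∑ i ∈ Finset.range N,
        (al (i + 1) - ga 0 + if i + 1 < j then 1 else 0) * (l (i + 1) - l i) +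
      (ga 1 - ga 0 - 1 + if 0 < j then 1 else 0) * l 0 -
      (ga (N + 1) - ga 0 - 1 + if N < j then 1 else 0) * l N := by
  induction N with
  | zero => simp
  | succ N ih =>
    rw [Finset.sum_range_succ, Finset.sum_range_succ, ih]
    rcases lt_trichotomy (N + 1) j with h | h | h
    · rw [if_pos (show N < j by omega), if_pos h, if_neg h.ne]
      ring
    · rw [if_pos (show N < j by omega), if_neg h.not_lt, if_pos h]
      ring
    · rw [if_neg (show ¬ N < j by omega), if_neg h.not_gt, if_neg h.ne']
      ring

theorem sum_Icc_add_eq_sum_range (hL : 2 ≤ L) (G : ℕ → ℂ) :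
    ∑ k ∈ Finset.Icc 1 (L - 1), G k + G L = ∑ k ∈ Finset.range L, G (1 + k) := by
  obtain ⟨N, rfl⟩ : ∃ N, L = N + 1 := ⟨L - 1, by omega⟩
  rw [Finset.sum_range_succ, Nat.add_sub_cancel, add_comm 1 N]
  congr 1
  rw [← Finset.Ico_add_one_right_eq_Icc, Finset.sum_Ico_eq_sum_range]
  simp

theorem add_mod_eq_iff {n i j : ℕ} (hi : i < L) (hj : j < L) :
    (n + i) % L = (n + j) % L ↔ i = j := by
  refine ⟨fun h => ?_, fun h => by rw [h]⟩
  exact Nat.ModEq.eq_of_lt_of_lt (Nat.ModEq.add_left_cancel' n h) hi hj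

theorem log_ratio {n : ℕ} (hn : n < L) {u : Fin (L - 1) → ℝ} (hu : u ∈ simplex L n)
    (i : Fin (L - 1)) :
    (Real.log (ratio L n u i) : ℂ) = logR L u (n + i + 1) - logR L u (n + i) := by
  rw [ratio, Real.log_div (rseq_pos hn hu _).ne' (rseq_pos hn hu _).ne', Complex.ofReal_sub]
  rfl

theorem logDiff_add {n : ℕ} (hn : n < L) (w : ℂ) {u : Fin (L - 1) → ℝ} (hu : u ∈ simplex L n)
    (i : Fin (L - 1)) :
    logDiff L n w u (n + i + 1) = logR L u (n + i) + (Real.log (1 - ratio L n u i) : ℂ) := by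
  have hi := i.2
  have hne : (n + i + 1) % L ≠ n := by
    intro h
    have h' : (n + (i + 1)) % L = (n + 0) % L := by
      rw [← add_assoc, h, add_zero, Nat.mod_eq_of_lt hn]
    exact absurd ((add_mod_eq_iff (by omega) (by omega)).1 h') (by omega)
  have h0 := rseq_pos hn hu (n + i)
  have h1 := ratio_mem_unitCube hn hu i trivial
  rw [logDiff, if_neg hne, show n + i + 1 + L - 1 = n + i + L by omega, rseq_add, logR,
    ← Complex.ofReal_add, ← Real.log_mul h0.ne' (sub_pos.2 h1.2).ne', ratio]
  congr 2
  field_simp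

/-- The exponent of the integrand, without the power of `x` and the constant factor, in the
coordinates given by the ratios. -/
theorem exponent_eq (hL : 2 ≤ L) {n : ℕ} (hn : n < L) (p : Params L) (w : ℂ)
    {u : Fin (L - 1) → ℝ} (hu : u ∈ simplex L n) {j : ℕ} (hj : j < L) :
    ∑ k ∈ Finset.Icc 1 (L - 1), ((p.zeta k + 1) * logR L u k +
        (p.eta k - if k = (n + j) % L then 0 else 1) * logDiff L n w u k) -
      (p.beta + if (n + j) % L = 0 then 0 else 1) * logDiff L n w u L =
    ∑ i : Fin (L - 1), (shiftLeft p n j i * (Real.log (ratio L n u i) : ℂ) +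
        (shiftRight p n j i - 1) * (Real.log (1 - ratio L n u i) : ℂ)) -
      shiftX p n j * logOneSub L n w u := by
  have hL0 : 0 < L := by omega
  have hper : ∀ k, (k + L) % L = k % L := fun k => Nat.add_mod_right k L
  have hal : ∀ k, p.alpha (k + L) = p.alpha k + 1 := fun k => by
    simpa using alpha_add_mul hL0 p k 1
  have hga : ∀ k, p.gamma (k + L) = p.gamma k + 1 := fun k => by
    simpa using gamma_add_mul hL0 p k 1
  set G : ℕ → ℂ := fun k => (p.zeta k + 1) * logR L u k +
    (p.eta k - if k % L = (n + j) % L then 0 else 1) * logDiff L n w u k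
  have hG : ∀ k, G (k + L) = G k := by
    intro k
    simp only [G, Params.zeta, Params.eta, logR, logDiff, hper, rseq_add, hal, hga,
      show k + L + 1 = k + 1 + L by ring, show k + L + L - 1 = k + L - 1 + L by omega]
    ring
  -- The term `k = L` is the contribution of `1 - x t_{L-1}`, since `r_L = 1` and `η_L = -β`.
  have hGL : G L = -(p.beta + if (n + j) % L = 0 then 0 else 1) * logDiff L n w u L := by
    have h1 : logR L u L = 0 := by rw [logR, rseq_self]; simp
    have h2 : p.eta L = -p.beta := by
      have h3 := hal 0
      have h4 := hga 0
      rw [zero_add] at h3 h4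
      rw [Params.eta, h3, h4]
      simp [Params.alpha, Params.gamma, coord, Params.beta]
    simp only [G, h1, h2, Nat.mod_self, eq_comm (a := 0)]
    ring
  have hLHS : ∑ k ∈ Finset.Icc 1 (L - 1), ((p.zeta k + 1) * logR L u k +
        (p.eta k - if k = (n + j) % L then 0 else 1) * logDiff L n w u k) =
      ∑ k ∈ Finset.Icc 1 (L - 1), G k := by
    refine Finset.sum_congr rfl fun k hk => ?_
    have := Finset.mem_Icc.1 hk
    simp only [G, Nat.mod_eq_of_lt (show k < L by omega)]
  have hsum := sum_Icc_add_eq_sum_range hL G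
  rw [sum_range_add_of_periodic hG, ← sum_range_add_of_periodic hG n] at hsum
  have hsplit : ∑ k ∈ Finset.range L, G (n + k) =
      ∑ i ∈ Finset.range (L - 1), G (n + (i + 1)) + G (n + 0) := by
    rw [← Finset.sum_range_succ' (fun k => G (n + k)), Nat.sub_add_cancel (by omega)]
  rw [hsplit, hGL, ← Fin.sum_univ_eq_sum_range (fun i => G (n + (i + 1)))] at hsum
  have hGi : ∀ i : Fin (L - 1), G (n + (i + 1)) =
      (shiftRight p n j i - 1) * (Real.log (1 - ratio L n u i) : ℂ) +
      (fun i : ℕ => (p.alpha (n + (i + 1)) - p.gamma (n + (i + 2)) + 1) * logR L u (n + (i + 1)) +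
        (p.gamma (n + (i + 1)) - p.alpha (n + (i + 1)) - if i + 1 = j then 0 else 1) *
          logR L u (n + i)) i := by
    intro i
    have hi := i.2
    have h1 : (n + (i + 1)) % L = (n + j) % L ↔ (i : ℕ) + 1 = j := add_mod_eq_iff (by omega) hj
    have h2 := logDiff_add hn w hu i
    rw [add_assoc] at h2
    simp only [G, h1, h2, shiftRight, rightExp, Params.zeta, Params.eta]
    rw [show n + (i + 1) + 1 = n + ((i : ℕ) + 2) by ring,
      show n + i + 1 = n + ((i : ℕ) + 1) by ring]
    split_ifs <;> ring
  have hGn : G (n + 0) = (p.alpha n - p.gamma (n + 1) + 1) * logR L u n +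
      (p.gamma n - p.alpha n - if j = 0 then 0 else 1) * (logR L u n + logOneSub L n w u) := by
    have h1 : n % L = (n + j) % L ↔ 0 = j := by
      have := add_mod_eq_iff (n := n) hL0 hj
      rwa [add_zero] at this
    have h2 : logDiff L n w u n = logR L u n + logOneSub L n w u := if_pos (Nat.mod_eq_of_lt hn)
    simp only [G, add_zero, h1, h2, Params.zeta, Params.eta, eq_comm (a := 0)]
  have hparts := sum_exponents_eq (fun k => p.alpha (n + k)) (fun k => p.gamma (n + k))
    (fun k => logR L u (n + k)) j (L - 1)
  simp only [Nat.sub_add_cancel (show 1 ≤ L by omega), add_zero, hga,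
    if_neg (show ¬ L - 1 < j by omega)] at hparts
  have hleft : ∑ i : Fin (L - 1), shiftLeft p n j i * (Real.log (ratio L n u i) : ℂ) =
      ∑ i ∈ Finset.range (L - 1), (p.alpha (n + (i + 1)) - p.gamma n + if i + 1 < j then 1 else 0) *
        (logR L u (n + (i + 1)) - logR L u (n + i)) := by
    rw [← Fin.sum_univ_eq_sum_range (fun i => (p.alpha (n + (i + 1)) - p.gamma n +
      if i + 1 < j then 1 else 0) * (logR L u (n + (i + 1)) - logR L u (n + i)))]
    refine Finset.sum_congr rfl fun i _ => ?_
    rw [log_ratio hn hu, shiftLeft, leftExp, add_assoc n]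
  have hfin : ∑ i : Fin (L - 1), G (n + (i + 1)) = _ :=
    (Finset.sum_congr rfl fun i _ => hGi i).trans Finset.sum_add_distrib
  rw [Fin.sum_univ_eq_sum_range (fun i : ℕ =>
    (p.alpha (n + (i + 1)) - p.gamma (n + (i + 2)) + 1) * logR L u (n + (i + 1)) +
      (p.gamma (n + (i + 1)) - p.alpha (n + (i + 1)) - if i + 1 = j then 0 else 1) *
        logR L u (n + i)), hparts, ← hleft] at hfin
  rw [hfin, hGn] at hsum
  rw [hLHS, Finset.sum_add_distrib (s := (Finset.univ : Finset (Fin (L - 1)))), shiftX]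
  rcases Nat.eq_zero_or_pos j with rfl | h
  · simp only [lt_irrefl, if_true, if_false] at hsum ⊢
    linear_combination hsum
  · simp only [h, h.ne', if_true, if_false] at hsum ⊢
    linear_combination hsum

theorem jacobian_eq {n : ℕ} (hn : n < L) (w : ℂ) :
    jacobian L n (Complex.exp w) =
      Complex.exp (-∑ k ∈ Finset.Icc 1 (L - 1), xExp n k * w) := by
  unfold jacobian xExp
  split_ifs with h
  · simp [h]
  · rw [← Finset.sum_mul, Finset.sum_boole,
      show (Finset.Icc 1 (L - 1)).filter (fun k => n ≠ 0 ∧ n ≤ k) = Finset.Icc n (L - 1) by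
        ext k; simp; omega, Nat.card_Icc, show L - 1 + 1 - n = L - n by omega, one_div,
      ← Complex.exp_neg, ← Complex.exp_nat_mul, mul_neg]

/-- The total exponent of `1 / x` in the integrand. -/
theorem sum_xExp_eq (hL : 2 ≤ L) {n : ℕ} (hn : n < L) (p : Params L) {m : ℕ} (hm : m < L) :
    ∑ k ∈ Finset.Icc 1 (L - 1),
        xExp n k * (p.zeta k + p.eta k - (if k = m then 0 else 1) + 1) =
      p.gamma n - if m < n then 1 else 0 := by
  have hγ0 : p.gamma 0 = 0 := by simp [Params.gamma, coord]
  have hγL : p.gamma L = 1 := by simpa [hγ0] using gamma_add_mul (by omega) p 0 1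
  rcases Nat.eq_zero_or_pos n with rfl | h
  · simp [xExp, hγ0]
  · have h1 : ∀ k, xExp n k * (p.zeta k + p.eta k - (if k = m then 0 else 1) + 1) =
        if n ≤ k then (p.gamma k - p.gamma (k + 1)) + (if k = m then 1 else 0) else 0 := by
      intro k
      simp only [xExp, Params.zeta, Params.eta, h.ne', ne_eq, not_false_eq_true, true_and]
      split_ifs <;> ring
    rw [Finset.sum_congr rfl fun k _ => h1 k, ← Finset.sum_filter,
      show (Finset.Icc 1 (L - 1)).filter (fun k => n ≤ k) = Finset.Ico n L by ext k; simp; omega,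
      Finset.sum_add_distrib, Finset.sum_Ico_eq_sum_range]
    have h2 : ∑ k ∈ Finset.range (L - n), (p.gamma (n + k) - p.gamma (n + k + 1)) =
        p.gamma n - 1 := by
      have := Finset.sum_range_sub' (fun k => p.gamma (n + k)) (L - n)
      rwa [add_zero, Nat.add_sub_cancel' hn.le, hγL] at this
    rw [h2, Finset.sum_ite_eq']
    simp only [Finset.mem_Ico, hm, and_true]
    rcases lt_or_ge m n with h | h
    · rw [if_neg (by omega), if_pos h]; ring
    · rw [if_pos h, if_neg (by omega)]; ring

/-- The form `φ_m` in terms of logarithms `D k` of `t_{k-1} - t_k` and `X` of `1 - x t_{L-1}`; the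
sign comes from `x t_{L-1} - 1 = -exp X`. -/
theorem phi_eq (hL : 2 ≤ L) {m : ℕ} (hm : m < L) {x : ℂ} {t : ℕ → ℂ} {D : ℕ → ℂ} {X : ℂ}
    (hD : ∀ k ∈ Finset.Icc 1 (L - 1), Complex.exp (D k) = t (k - 1) - t k)
    (hX : Complex.exp X = 1 - x * t (L - 1)) :
    phi L m x t = (if m = 0 then 1 else -1) *
      Complex.exp (-∑ k ∈ Finset.Icc 1 (L - 1), (if k = m then 0 else 1) * D k
        - (if m = 0 then 0 else 1) * X) := by
  unfold phi
  split_ifs with h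
  · have : ∑ k ∈ Finset.Icc 1 (L - 1), (if k = m then 0 else 1) * D k =
        ∑ k ∈ Finset.Icc 1 (L - 1), D k := by
      refine Finset.sum_congr rfl fun k hk => ?_
      have := Finset.mem_Icc.1 hk
      rw [if_neg (by omega), one_mul]
    rw [this, ← Finset.prod_congr rfl hD, ← Complex.exp_sum, zero_mul, sub_zero, Complex.exp_neg,
      one_div, one_mul]
  · have hmem : m ∈ Finset.Icc 1 (L - 1) := Finset.mem_Icc.2 ⟨by omega, by omega⟩
    have : ∑ k ∈ Finset.Icc 1 (L - 1), (if k = m then 0 else 1) * D k =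
        ∑ k ∈ (Finset.Icc 1 (L - 1)).erase m, D k := by
      rw [← Finset.add_sum_erase _ _ hmem, if_pos rfl, zero_mul, zero_add]
      refine Finset.sum_congr rfl fun k hk => ?_
      rw [if_neg (Finset.ne_of_mem_erase hk), one_mul]
    rw [this, ← Finset.prod_congr rfl fun k hk => hD k (Finset.mem_of_mem_erase hk),
      ← Complex.exp_sum, one_mul, Complex.exp_sub, Complex.exp_neg,
      show x * t (L - 1) - 1 = -Complex.exp X by rw [hX]; ring]
    have := Complex.exp_ne_zero X
    field_simp

theorem prod_coord_eq {n : ℕ} (hn : n < L) {u : Fin (L - 1) → ℝ} (hu : u ∈ simplex L n) :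
    ((∏ i, u i : ℝ) : ℂ) = Complex.exp (∑ k ∈ Finset.Icc 1 (L - 1), logR L u k) := by
  have h1 : Finset.Icc 1 (L - 1) = Finset.Ico 1 (L - 1 + 1) := by ext; simp
  rw [Complex.exp_sum, Finset.prod_congr rfl fun k _ => exp_logR hn hu k, h1,
    Finset.prod_Ico_eq_prod_range, Nat.add_sub_cancel,
    ← Fin.prod_univ_eq_prod_range (fun k => (rseq L u (1 + k) : ℂ)), Complex.ofReal_prod]
  refine Finset.prod_congr rfl fun i _ => ?_
  rw [add_comm, rseq_succ]

theorem prod_mul_betaProd_eq {ι : Type*} [Fintype ι] (a b : ι → ℂ) {s : ι → ℝ}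
    (hs : s ∈ univ.pi fun _ => Ioo (0 : ℝ) 1) :
    ((∏ i, s i : ℝ) : ℂ) * betaProd a b s = Complex.exp (∑ i, (a i * (Real.log (s i) : ℂ) +
      (b i - 1) * (Real.log (1 - s i) : ℂ))) := by
  rw [Complex.exp_sum, betaProd, Complex.ofReal_prod, ← Finset.prod_mul_distrib]
  refine Finset.prod_congr rfl fun i _ => ?_
  have h0 := (hs i trivial).1
  have h1 := sub_pos.2 (hs i trivial).2
  have h0' : (s i : ℂ) ≠ 0 := by exact_mod_cast h0.ne'
  have h1' : (1 - s i : ℂ) ≠ 0 := by exact_mod_cast h1.ne'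
  have e0 : Complex.exp (Real.log (s i) : ℂ) = s i := by
    rw [← Complex.ofReal_exp, Real.exp_log h0]
  rw [Complex.cpow_def_of_ne_zero h0', Complex.cpow_def_of_ne_zero h1', ← Complex.ofReal_log h0.le,
    show (1 - s i : ℂ) = ((1 - s i : ℝ) : ℂ) by push_cast; rfl, ← Complex.ofReal_log h1.le]
  nth_rewrite 1 [← e0]
  rw [← Complex.exp_add, ← Complex.exp_add]
  congr 1
  ring

/-- The signs of the constants of the branches combine to the sign which distinguishes the form
`φ_n` from the others. -/
theorem sign_eq {n m j : ℕ} (hn : n < L) (hm : m < L) (hmj : m = n ↔ j = 0)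
    {cD : ℕ → ℂ} {cX : ℂ}
    (hD : ∀ k ∈ Finset.Icc 1 (L - 1), Complex.exp (cD k) = if k = n then -1 else 1)
    (hX : Complex.exp cX = if n = 0 then 1 else -1) :
    (if m = 0 then 1 else -1) *
      Complex.exp (-∑ k ∈ Finset.Icc 1 (L - 1), (if k = m then 0 else 1) * cD k
        - (if m = 0 then 0 else 1) * cX) = if j = 0 then 1 else -1 := by
  have h1 : Complex.exp (∑ k ∈ Finset.Icc 1 (L - 1), (if k = m then 0 else 1) * cD k) =
      if n ∈ Finset.Icc 1 (L - 1) then (if n = m then 1 else -1) else 1 := by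
    rw [Complex.exp_sum, ← Finset.prod_ite_eq' (Finset.Icc 1 (L - 1)) n
      fun k => if k = m then (1 : ℂ) else -1]
    refine Finset.prod_congr rfl fun k hk => ?_
    split_ifs with h h' h'
    · simp
    · simp
    · rw [one_mul, hD k hk, if_pos h']
    · rw [one_mul, hD k hk, if_neg h']
  have h2 : Complex.exp ((if m = 0 then 0 else 1) * cX) =
      if m = 0 then 1 else (if n = 0 then 1 else -1) := by
    split_ifs with h h'
    · simp
    · rw [one_mul, hX, if_pos h']
    · rw [one_mul, hX, if_neg h']
  rw [Complex.exp_sub, Complex.exp_neg, h1, h2]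
  have hmem : n ∈ Finset.Icc 1 (L - 1) ↔ n ≠ 0 := by rw [Finset.mem_Icc]; omega
  simp only [hmem, ← hmj, eq_comm (a := n) (b := m)]
  by_cases h0 : n = 0
  · subst h0
    by_cases h : m = 0 <;> simp [h]
  · by_cases h : m = n
    · subst h
      simp [h0]
    · by_cases h' : m = 0
      · subst h'
        simp [h0, h]
      · simp [h0, h, h']

/-- The integrand in the coordinates given by the ratios, with respect to the invariant measure
`∏ du_i / u_i`, is that of an Euler integral. -/
theorem Branch.exists_integrand_eq (hL : 2 ≤ L) {n : ℕ} (hn : n < L) (B : Branch L n) :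
    ∃ K : Params L → ℂ, Differentiable ℂ K ∧ (∀ p, K p ≠ 0) ∧
      ∀ p, ∀ w ∈ cover, ∀ j < L, ∀ u ∈ simplex L n,
        ((∏ i, u i : ℝ) : ℂ) * B.integrand p w ((n + j) % L) u =
          ((∏ i, ratio L n u i : ℝ) : ℂ) *
            ((K p * Complex.exp (p.b n * w) * (if (n + j) % L < n then Complex.exp w else 1) *
              (if j = 0 then 1 else -1)) *
              (betaProd (shiftLeft p n j) (shiftRight p n j) (ratio L n u) *
                (1 - Complex.exp w * (∏ i, ratio L n u i : ℝ)) ^ (-shiftX p n j))) := by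
  choose! cT hcT hT using fun k hk => B.exists_logT_eq hn (k := k) hk
  choose! cD hcD hD using fun k hk => B.exists_logD_eq hn (k := k) hk
  obtain ⟨cX, hcX, hX⟩ := B.exists_logX_eq hn hL
  have hbeta : Differentiable ℂ fun p : Params L => p.beta := by unfold Params.beta; fun_prop
  refine ⟨fun p => Complex.exp (∑ k ∈ Finset.Icc 1 (L - 1), (p.zeta k * cT k + p.eta k * cD k)
    - p.beta * cX), ?_, fun p => Complex.exp_ne_zero _, ?_⟩
  · refine Differentiable.cexp (Differentiable.fun_sub (Differentiable.fun_sum fun k _ => ?_)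
      (hbeta.mul_const cX))
    exact (((differentiable_alpha k).fun_sub (differentiable_gamma (k + 1))).mul_const _).fun_add
      (((differentiable_gamma k).fun_sub (differentiable_alpha k)).mul_const _)
  · intro p w hw j hj u hu
    set m := (n + j) % L with hm
    have hmL : m < L := Nat.mod_lt _ (by omega)
    have hmj : m = n ↔ j = 0 := by
      have := add_mod_eq_iff (n := n) hj (show 0 < L by omega)
      rwa [add_zero, Nat.mod_eq_of_lt hn] at this
    -- Collect the exponents: the constants of the branches, the powers of `x`, and the rest.
    have hsum : ∑ k ∈ Finset.Icc 1 (L - 1), (p.zeta k * B.logT k w u + p.eta k * B.logD k w u)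
          - p.beta * B.logX w u
          + (-∑ k ∈ Finset.Icc 1 (L - 1), (if k = m then 0 else 1) * B.logD k w u
            - (if m = 0 then 0 else 1) * B.logX w u)
          + (-∑ k ∈ Finset.Icc 1 (L - 1), xExp n k * w)
          + ∑ k ∈ Finset.Icc 1 (L - 1), logR L u k =
        (∑ k ∈ Finset.Icc 1 (L - 1), (p.zeta k * cT k + p.eta k * cD k) - p.beta * cX)
        + (-∑ k ∈ Finset.Icc 1 (L - 1), (if k = m then 0 else 1) * cD k
            - (if m = 0 then 0 else 1) * cX)
        - w * (∑ k ∈ Finset.Icc 1 (L - 1),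
            xExp n k * (p.zeta k + p.eta k - (if k = m then 0 else 1) + 1))
        + (∑ k ∈ Finset.Icc 1 (L - 1), ((p.zeta k + 1) * logR L u k +
            (p.eta k - if k = m then 0 else 1) * logDiff L n w u k) -
          (p.beta + if m = 0 then 0 else 1) * logDiff L n w u L) := by
      have e : ∀ k ∈ Finset.Icc 1 (L - 1),
          p.zeta k * B.logT k w u + p.eta k * B.logD k w u
            - (if k = m then 0 else 1) * B.logD k w u - xExp n k * w + logR L u k =
          (p.zeta k * cT k + p.eta k * cD k) - (if k = m then 0 else 1) * cD k
            - w * (xExp n k * (p.zeta k + p.eta k - (if k = m then 0 else 1) + 1))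
            + ((p.zeta k + 1) * logR L u k +
            (p.eta k - if k = m then 0 else 1) * logDiff L n w u k) := by
        intro k hk
        rw [hT k hk w hw u hu, hD k hk w hw u hu]
        ring
      have e' := Finset.sum_congr rfl e
      simp only [Finset.sum_add_distrib, Finset.sum_sub_distrib, ← Finset.mul_sum] at e' ⊢
      rw [hX w hw u hu]
      linear_combination e'
    have hone : 1 - Complex.exp w * (∏ i, ratio L n u i : ℝ) ≠ 0 :=
      Complex.slitPlane_ne_zero (one_sub_mem_slitPlane hn hw hu)
    have hpow : Complex.exp (-(w * (p.gamma n - if m < n then 1 else 0))) =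
        Complex.exp (p.b n * w) * (if m < n then Complex.exp w else 1) := by
      rw [Params.b]
      split_ifs
      · rw [← Complex.exp_add]
        congr 1
        ring
      · rw [mul_one]
        congr 1
        ring
    have hsign := sign_eq hn hmL hmj hcD hcX
    rw [Branch.integrand, Branch.U, phi_eq hL hmL (fun k hk => B.exp_logD k hk w hw u hu)
      (B.exp_logX w hw u hu), jacobian_eq hn, prod_coord_eq hn hu]
    rw [sum_xExp_eq hL hn p hmL, exponent_eq hL hn p w hu hj] at hsum
    have hE := congrArg (fun z => (if m = 0 then (1 : ℂ) else -1) * Complex.exp z) hsum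
    rw [sub_eq_add_neg _ (w * _), sub_eq_add_neg _ (shiftX p n j * _)] at hE
    simp only [Complex.exp_add] at hE
    rw [hpow] at hE
    have hbp := prod_mul_betaProd_eq (shiftLeft p n j) (shiftRight p n j)
      (ratio_mem_unitCube hn hu)
    have hcp : (1 - Complex.exp w * (∏ i, ratio L n u i : ℝ)) ^ (-shiftX p n j) =
        Complex.exp (-(shiftX p n j * logOneSub L n w u)) := by
      rw [Complex.cpow_def_of_ne_zero hone, logOneSub]
      congr 1
      ring
    rw [hcp]
    rw [← hbp] at hE
    rw [← hsign]
    linear_combination hE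

/-! ### Evaluation of the integrals -/

/-- In terms of the residue `m` of the index `n + j`, the difference of consecutive series is the
component number `m` of the local solution. -/
theorem frobSeries_sub_eq {p : Params L} {n : ℕ} (hn : n < L) (hp : NonResonant p n) {j : ℕ}
    (hj : j < L) {x : ℂ} (hx : ‖x‖ < 1) :
    (if (n + j) % L < n then x else 1) *
        (frobSeries p n (n + j + 1) x - frobSeries p n (n + j) x) =
      frobSeries p n ((n + j) % L + 1) x - frobSeries p n ((n + j) % L) x := by
  rcases lt_or_ge (n + j) L with h | h
  · rw [Nat.mod_eq_of_lt h, if_neg (by omega), one_mul]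
  · obtain ⟨m, hm⟩ := Nat.exists_eq_add_of_le' h
    have hmod : (n + j) % L = m := by
      rw [hm, Nat.add_mod_right, Nat.mod_eq_of_lt (by omega)]
    rw [hmod, if_pos (by omega), frobSeries_eq_mul hn hp (show m + 1 ≤ n by omega) hx,
      frobSeries_eq_mul hn hp (show m ≤ n by omega) hx, hm, add_right_comm m L 1]
    ring

/-- The integrals over `Δ_n` are a multiple of the local solution with the exponent `-γ_n`; the
factor is holomorphic in the parameters and vanishes nowhere, apart from the product of Gamma
functions. -/
theorem Branch.exists_integral_eq (hL : 2 ≤ L) {n : ℕ} (hn : n < L) (B : Branch L n) :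
    ∃ K : Params L → ℂ, Differentiable ℂ K ∧ (∀ p, K p ≠ 0) ∧
      ∀ p ∈ convergent L n, ∀ w ∈ cover, ∀ m : Fin L,
        IntegrableOn (B.integrand p w m) (simplex L n) ∧
        ∫ u in simplex L n, B.integrand p w m u =
          K p * gammaConst p n * localSolution p n w m := by
  obtain ⟨K, hKd, hK0, hK⟩ := B.exists_integrand_eq hL hn
  obtain ⟨κ, hκ, hint⟩ := exists_integral_simplex_eq hn
  refine ⟨fun p => κ * K p, hKd.const_mul _, fun p => mul_ne_zero
    (Complex.ofReal_ne_zero.2 hκ.ne') (hK0 p), fun p hp w hw m => ?_⟩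
  have hx := norm_exp_lt_one hw
  have hres := nonResonant_of_mem_convergent (by omega) hp
  obtain ⟨j, hj, hjm⟩ := exists_rseq_eq hn m
  rw [Nat.mod_eq_of_lt m.2] at hjm
  have hE := (euler_integral (re_shiftLeft_pos hp j) (re_shiftRight_pos hp j) (shiftX p n j) hx).1
  have hI := hint (B.integrand p w m) _ (fun u hu => by
    have := hK p w hw j hj u hu
    rw [hjm] at this
    exact this) (hE.const_mul _)
  refine ⟨hI.1, ?_⟩
  have hT := frobSeries_sub_eq hn hres hj hx
  rw [hjm] at hT
  have hs : (if j = 0 then (1 : ℂ) else -1) * (if j = 0 then 1 else -1) = 1 := by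
    split_ifs <;> norm_num
  rw [hI.2, integral_const_mul, euler_integral_eq hn hp hj hx, localSolution, ← hT]
  linear_combination (κ * K p * Complex.exp (p.b n * w) *
    (if (m : ℕ) < n then Complex.exp w else 1) * gammaConst p n *
      (frobSeries p n (n + j + 1) (Complex.exp w) - frobSeries p n (n + j) (Complex.exp w))) * hs

/-! ### Generic parameters -/

theorem nonResonant_of_mem_generic {p : Params L} (hp : p ∈ generic L) {n : ℕ} (hn : n < L) :
    NonResonant p n :=
  nonResonant_of_forall (fun k hk j => (hp n hn k hk j).2.2) (by omega)

theorem gammaConst_ne_zero {p : Params L} (hp : p ∈ generic L) {n : ℕ} (hn : n < L) :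
    gammaConst p n ≠ 0 := by
  refine Finset.prod_ne_zero_iff.2 fun i _ => ?_
  have h := hp n hn (i + 1) (Finset.mem_Icc.2 ⟨by omega, i.2⟩)
  exact mul_ne_zero (mul_ne_zero (Complex.Gamma_ne_zero fun j => (h j).1)
    (Complex.Gamma_ne_zero fun j => (h j).2.1))
    (inv_ne_zero (Complex.Gamma_ne_zero fun j => (h j).2.2))

theorem differentiableAt_gammaConst {p : Params L} (hp : p ∈ generic L) {n : ℕ} (hn : n < L) :
    DifferentiableAt ℂ (fun p => gammaConst p n) p := by
  refine differentiableAt_finset_prod fun i _ => ?_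
  have h := hp n hn (i + 1) (Finset.mem_Icc.2 ⟨by omega, i.2⟩)
  have hd : ∀ k l, DifferentiableAt ℂ (fun p : Params L => p.gamma k - p.alpha l) p := fun k l =>
    (differentiable_gamma k p).fun_sub (differentiable_alpha l p)
  have hd' : ∀ k l, DifferentiableAt ℂ (fun p : Params L => p.alpha k - p.gamma l) p := fun k l =>
    (differentiable_alpha k p).fun_sub (differentiable_gamma l p)
  have hd'' : ∀ k l, DifferentiableAt ℂ (fun p : Params L => p.gamma k - p.gamma l) p := fun k l =>
    (differentiable_gamma k p).fun_sub (differentiable_gamma l p)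
  refine DifferentiableAt.fun_mul (DifferentiableAt.fun_mul ?_ ?_) ?_
  · exact (Complex.differentiableAt_Gamma _ fun j => (h j).1).comp p (hd' _ _)
  · exact (Complex.differentiableAt_Gamma _ fun j => (h j).2.1).comp p (hd _ _)
  · exact (Complex.differentiable_one_div_Gamma _).comp p (hd'' _ _)

theorem differentiableAt_localSolution {p : Params L} {n : ℕ} (hn : n < L) (hp : NonResonant p n)
    {w : ℂ} (hw : w ∈ cover) (m : Fin L) :
    DifferentiableAt ℂ (fun p => localSolution p n w m) p := by
  have hx := norm_exp_lt_one hw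
  have hb : DifferentiableAt ℂ (fun p : Params L => p.b n) p := (differentiable_gamma n p).fun_neg
  exact (hb.mul_const w).cexp.fun_mul ((differentiableAt_frobSeries_param hn hp _ hx).fun_sub
    (differentiableAt_frobSeries_param hn hp _ hx))

end ThomaeSystem

end

theorem theorem3p3 (L : ℕ) (hL : 2 ≤ L) (B : ∀ n : Fin L, ThomaeSystem.Branch L n) :
    ∃ Y : ThomaeSystem.Params L → ℂ → Matrix (Fin L) (Fin L) ℂ,
      (∀ n : Fin L, ∀ p ∈ ThomaeSystem.convergent L n, ∀ w ∈ ThomaeSystem.cover, ∀ m : Fin L,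
        MeasureTheory.IntegrableOn ((B n).integrand p w m) (ThomaeSystem.simplex L n) ∧
        Y p w m n = ∫ u in ThomaeSystem.simplex L n, (B n).integrand p w m u) ∧
      (∀ w ∈ ThomaeSystem.cover, ∀ m n : Fin L,
        DifferentiableOn ℂ (fun p => Y p w m n) (ThomaeSystem.generic L)) ∧
      ∀ p ∈ ThomaeSystem.generic L,
        ThomaeSystem.IsFundamentalSystem p (Y p) ∧ ThomaeSystem.HasTriangularForm p (Y p) := by
  choose K hKd hK0 hK using fun n : Fin L => (B n).exists_integral_eq hL n.2
  refine ⟨fun p w => Matrix.of fun m n =>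
    (K n p * ThomaeSystem.gammaConst p n) * ThomaeSystem.localSolution p n w m, ?_, ?_, ?_⟩
  · intro n p hp w hw m
    obtain ⟨h1, h2⟩ := hK n p hp w hw m
    exact ⟨h1, h2.symm⟩
  · intro w hw m n p hp
    exact (((hKd n p).fun_mul (ThomaeSystem.differentiableAt_gammaConst hp n.2)).fun_mul
      (ThomaeSystem.differentiableAt_localSolution n.2
        (ThomaeSystem.nonResonant_of_mem_generic hp n.2) hw m)).differentiableWithinAt
  · intro p hp
    have hres : ∀ n < L, ThomaeSystem.NonResonant p n := fun n hn =>
      ThomaeSystem.nonResonant_of_mem_generic hp hn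
    have hc : ∀ n : Fin L, K n p * ThomaeSystem.gammaConst p n ≠ 0 := fun n =>
      mul_ne_zero (hK0 n p) (ThomaeSystem.gammaConst_ne_zero hp n.2)
    exact ⟨ThomaeSystem.isFundamentalSystem_localSolution hres hc,
      ThomaeSystem.hasTriangularForm_localSolution hres hc⟩
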